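/- Let $\mathrm{Sol}$ be the Lie group of matrices $\begin{pmatrix} e^{-z}&0&x\\0&e^{z}&y\\0&0&1\end{pmatrix}$, $x,y,z\in\mathbb R$, with the left-invariant metric $ds^2=e^{2z}dx^2+e^{-2z}dy^2+dz^2$. For this metric the basis of the Lie algebra $$e_1=\begin{pmatrix}0&0&1\\0&0&0\\0&0&0\end{pmatrix},\quad e_2=\begin{pmatrix}0&0&0\\0&0&1\\0&0&0\end{pmatrix},\quad e_3=\begin{pmatrix}-1&0&0\\0&1&0\\0&0&0\end{pmatrix}$$ is orthonormal; it is taken to be positively oriented. Write $\partial=\frac12(\partial_x-i\partial_y)$ and $\bar\partial=\frac12(\partial_x+i\partial_y)$ for a complex parameter $x+iy$. Let $f:M\to\mathrm{Sol}$ be a smooth immersed surface with a smooth chart of $M$ whose coordinate $z=x+iy$ is conformal, so that the induced metric is $e^{2\alpha}dz\,d\bar z$. Let $N$ be the unit normal for which $(f_x,f_y,N)$ is positively oriented, $H$ the mean curvature (half of the trace of the second fundamental form $\langle\nabla\,df,N\rangle$), and $A\,dz^2$, $A=\langle\nabla_{f_z}f_z,N\rangle$, the Hopf differential. A generating spinor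 of $f$ is a smooth $\psi=(\psi_1,\psi_2)$ with values in $\mathbb C^2$ on the domain of the chart such that $f^{-1}\partial f=Z_1e_1+Z_2e_2+Z_3e_3$, where $$Z_1=\tfrac i2(\bar\psi_2^2+\psi_1^2),\quad Z_2=\tfrac12(\bar\psi_2^2-\psi_1^2),\quad Z_3=\psi_1\bar\psi_2 .$$ Let $C=\{Z_3\ne0\}$, and let $B_0$ be the interior of $\{Z_3=0\}$. **Theorem.** (1) Every generating spinor $\psi$ of $f$ satisfies the Dirac equation $$\partial\psi_2+U\psi_1=0,\qquad -\bar\partial\psi_1+V\psi_2=0 \tag{D}$$ in $C$ with $$U=\frac H2(|\psi_1|^2+|\psi_2|^2)-\frac12\bar\psi_2^2\,\frac{\bar\psi_1}{\psi_1},\qquad V=\frac H2(|\psi_1|^2+|\psi_2|^2)+\frac12\bar\psi_1^2\,\frac{\bar\psi_2}{\psi_2},$$ and satisfies the free Dirac equation $\bar\partial\psi_1=\partial\psi_2=0$ in $B_0$. (2) Let $D\subset\mathbb C$ be a simply connected domain, $\psi:D\to\mathbb C^2\setminus\{0\}$ smooth, and $H$ a real-valued function on $D$ such that $\psi$ satisfies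 (D) with the potentials $U,V$ formed from $H$ at the points of $D$ where $Z_3=\psi_1\bar\psi_2\neq0$, and satisfies the free Dirac equation in the interior of $\{Z_3=0\}$ (in particular, $Z_3$ may be nowhere zero on $D$). Then for all $P\in D$ and $g\in\mathrm{Sol}$ there is a smooth immersion $f:D\to\mathrm{Sol}$ with $f(P)=g$ for which the parameter is conformal, $\psi$ is a generating spinor, and the mean curvature equals $H$ wherever $Z_3\ne0$. (3) For a surface as above, on the whole domain of the chart, $$A=(\bar\psi_2\,\partial\psi_1-\psi_1\,\partial\bar\psi_2)+\tfrac12(\bar\psi_2^4-\psi_1^4).$$ (4) In $B_0\cup C$ the Weingarten equations consist of the Dirac equation in (1) and $$\partial\psi_1=\alpha_z\psi_1+Ae^{-\alpha}\psi_2-\tfrac12\bar\psi_2^3,\qquad \bar\partial\psi_2=-\bar Ae^{-\alpha}\psi_1+\alpha_{\bar z}\psi_2-\tfrac12\bar\psi_1^3 .$$ (5) On the whole domain of the chart the Codazzi equations hold: $$\alpha_{z\bar z}-e^{-2\alpha}|A|^2+\tfrac14e^{2\alpha}H^2=\tfrac14\bigl(6|\psi_1|^2|\psi_2|^2-(|\psi_1|^4+|\psi_2|^4)\bigr),$$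 $$A_{\bar z}-\tfrac12H_ze^{2\alpha}=(|\psi_2|^4-|\psi_1|^4)\,\psi_1\bar\psi_2 .$$ -/

import Mathlib

open scoped Manifold ContDiff ComplexConjugate

noncomputable section

/-! # The group Sol and its left-invariant metric -/

/-- The matrix with rows `(e^{-z}, 0, x)`, `(0, e^z, y)`, `(0, 0, 1)`. -/
def solMatrix (x y z : ℝ) : Matrix (Fin 3) (Fin 3) ℝ :=
  !![Real.exp (-z), 0, x; 0, Real.exp z, y; 0, 0, 1]

theorem solMatrix_mul (x y z x' y' z' : ℝ) :
    solMatrix x y z * solMatrix x' y' z' =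
      solMatrix (Real.exp (-z) * x' + x) (Real.exp z * y' + y) (z + z') := by
  ext i j
  fin_cases i <;> fin_cases j <;>
    simp [solMatrix, Matrix.mul_apply, Fin.sum_univ_three, Real.exp_add, mul_comm]

theorem solMatrix_one : solMatrix 0 0 0 = 1 := by
  ext i j
  fin_cases i <;> fin_cases j <;> simp [solMatrix]

/-- The Lie group Sol, as a group of matrices. -/
def Sol : Subgroup (GL (Fin 3) ℝ) where
  carrier := {g | ∃ x y z : ℝ, (g : Matrix (Fin 3) (Fin 3) ℝ) = solMatrix x y z}
  one_mem' := ⟨0, 0, 0, by rw [solMatrix_one]; rfl⟩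
  mul_mem' := by
    rintro a b ⟨x, y, z, h⟩ ⟨x', y', z', h'⟩
    exact ⟨_, _, _, by rw [Units.val_mul, h, h', solMatrix_mul]⟩
  inv_mem' := by
    rintro a ⟨x, y, z, h⟩
    refine ⟨-(Real.exp z * x), -(Real.exp (-z) * y), -z, ?_⟩
    apply Units.inv_eq_of_mul_eq_one_right
    rw [h, solMatrix_mul, ← solMatrix_one]
    congr 1
    · rw [mul_neg, ← mul_assoc, ← Real.exp_add]; simp
    · rw [mul_neg, ← mul_assoc, ← Real.exp_add]; simp
    · simp

/-- The underlying matrix of an element of Sol. -/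
def Sol.toMat (g : Sol) : Matrix (Fin 3) (Fin 3) ℝ := ((g : GL (Fin 3) ℝ) : Matrix _ _ ℝ)

/-- The basis `e₁, e₂, e₃` of the Lie algebra of Sol (indexed by `0, 1, 2`). -/
def solBasis : Fin 3 → Matrix (Fin 3) (Fin 3) ℝ :=
  ![!![0, 0, 1; 0, 0, 0; 0, 0, 0], !![0, 0, 0; 0, 0, 1; 0, 0, 0], !![-1, 0, 0; 0, 1, 0; 0, 0, 0]]

/-- The coefficients of an element of the Lie algebra of Sol with respect to `e₁, e₂, e₃`. The
left-invariant metric is the one for which `e₁, e₂, e₃` is orthonormal, so that inner products are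
dot products of such coefficient vectors; the basis is taken to be positively oriented. -/
def solCoord (X : Matrix (Fin 3) (Fin 3) ℝ) : Fin 3 → ℝ := ![X 0 2, X 1 2, X 1 1]

theorem solCoord_sum (a : Fin 3 → ℝ) : solCoord (∑ k, a k • solBasis k) = a := by
  ext k
  fin_cases k <;> simp [solCoord, solBasis, Fin.sum_univ_three]

/-- `solAlpha i j k = ⟨[eᵢ, eⱼ], eₖ⟩`. -/
def solAlpha (i j k : Fin 3) : ℝ := solCoord ⁅solBasis i, solBasis j⁆ k

/-- The Levi-Civita connection of the left-invariant metric (Koszul formula):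
`solConn k j i` is the coefficient of `eᵢ` in `∇_{eₖ} eⱼ`. -/
def solConn (k j i : Fin 3) : ℝ := (solAlpha k j i + solAlpha i k j + solAlpha i j k) / 2

/-! # Maps from a plane domain to Sol -/

/-- The derivative of `F` at `ζ` in the direction `v`, translated to the unit: `F⁻¹ ∂ᵥF`. -/
def leftDeriv (F : ℂ → Sol) (v ζ : ℂ) : Matrix (Fin 3) (Fin 3) ℝ :=
  Sol.toMat (F ζ)⁻¹ * Matrix.of fun i j => fderiv ℝ (fun w => Sol.toMat (F w) i j) ζ v

/-- The components of `∂ᵥF` in the left-invariant orthonormal frame. -/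
def velocity (F : ℂ → Sol) (v ζ : ℂ) : Fin 3 → ℝ := solCoord (leftDeriv F v ζ)

/-- The covariant derivative `∇ᵥV` along `F` of the vector field along `F` with components `V`
in the left-invariant frame. -/
def covDeriv (F : ℂ → Sol) (V : ℂ → Fin 3 → ℝ) (v ζ : ℂ) : Fin 3 → ℝ := fun i =>
  fderiv ℝ (fun w => V w i) ζ v + ∑ k, ∑ j, velocity F v ζ k * V ζ j * solConn k j i

/-- `⟨∂ᵥF, ∂_wF⟩`, the first fundamental form. -/
def firstForm (F : ℂ → Sol) (v w ζ : ℂ) : ℝ := velocity F v ζ ⬝ᵥ velocity F w ζ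

/-- The components of the unit normal `N` for which `F_x, F_y, N` is positively oriented. -/
def unitNormal (F : ℂ → Sol) (ζ : ℂ) : Fin 3 → ℝ :=
  let c := crossProduct (velocity F 1 ζ) (velocity F Complex.I ζ)
  (Real.sqrt (c ⬝ᵥ c))⁻¹ • c

/-- `⟨∇ᵥ∂_wF, N⟩`, the second fundamental form. -/
def secondForm (F : ℂ → Sol) (v w ζ : ℂ) : ℝ :=
  covDeriv F (velocity F w) v ζ ⬝ᵥ unitNormal F ζ

/-- The parameter `ζ = x + iy` on `Ω` is conformal for `F`. -/
def IsConformalOn (Ω : Set ℂ) (F : ℂ → Sol) : Prop :=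
  ∀ ζ ∈ Ω, firstForm F 1 1 ζ = firstForm F Complex.I Complex.I ζ ∧ firstForm F 1 Complex.I ζ = 0

/-- The function `α` for which `e^{2α} |dζ|²` is the induced metric, in a conformal parameter. -/
def logFactor (F : ℂ → Sol) (ζ : ℂ) : ℝ := Real.log (firstForm F 1 1 ζ) / 2

/-- The mean curvature in a conformal parameter: half of the trace of the second fundamental
form with respect to the first one. -/
def meanCurvature (F : ℂ → Sol) (ζ : ℂ) : ℝ :=
  (secondForm F 1 1 ζ + secondForm F Complex.I Complex.I ζ) / (2 * firstForm F 1 1 ζ)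

/-- The coefficient `A = ⟨∇_{F_ζ} F_ζ, N⟩` of the Hopf differential `A dζ²`, expanded by
bilinearity from `F_ζ = (F_x - i F_y) / 2`. -/
def hopfCoeff (F : ℂ → Sol) (ζ : ℂ) : ℂ :=
  ((secondForm F 1 1 ζ - secondForm F Complex.I Complex.I ζ : ℝ) -
    Complex.I * (secondForm F 1 Complex.I ζ + secondForm F Complex.I 1 ζ : ℝ)) / 4

/-! # Spinors and Dirac equations -/

/-- The operator `∂ = (∂_x - i ∂_y) / 2`. -/
def dz (u : ℂ → ℂ) (ζ : ℂ) : ℂ := (fderiv ℝ u ζ 1 - Complex.I * fderiv ℝ u ζ Complex.I) / 2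

/-- The operator `∂̄ = (∂_x + i ∂_y) / 2`. -/
def dzbar (u : ℂ → ℂ) (ζ : ℂ) : ℂ := (fderiv ℝ u ζ 1 + Complex.I * fderiv ℝ u ζ Complex.I) / 2

/-- `Ψ = F⁻¹ ∂F`, a matrix of the complexified Lie algebra. -/
def leftDz (F : ℂ → Sol) (ζ : ℂ) : Matrix (Fin 3) (Fin 3) ℂ :=
  (1 / 2 : ℂ) • ((leftDeriv F 1 ζ).map Complex.ofReal -
    Complex.I • (leftDeriv F Complex.I ζ).map Complex.ofReal)

/-- The vector `(Z₁, Z₂, Z₃)` determined by a spinor `(a, b)`. -/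
def spinorVec (a b : ℂ) : Fin 3 → ℂ :=
  ![Complex.I / 2 * (conj b ^ 2 + a ^ 2), 1 / 2 * (conj b ^ 2 - a ^ 2), a * conj b]

/-- `ψ = (ψ₁, ψ₂)` is a generating spinor of `F` on `Ω`: `F⁻¹ ∂F = ∑ Zₖ eₖ`. -/
structure IsGeneratingSpinor (Ω : Set ℂ) (F : ℂ → Sol) (ψ₁ ψ₂ : ℂ → ℂ) : Prop where
  smooth₁ : ContDiffOn ℝ ∞ ψ₁ Ω
  smooth₂ : ContDiffOn ℝ ∞ ψ₂ Ω
  eq : ∀ ζ ∈ Ω, leftDz F ζ =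
    ∑ k, spinorVec (ψ₁ ζ) (ψ₂ ζ) k • (solBasis k).map Complex.ofReal

/-- The Dirac equation with the values `U`, `V` of the potentials at the point `ζ`. -/
def DiracAt (U V : ℂ) (ψ₁ ψ₂ : ℂ → ℂ) (ζ : ℂ) : Prop :=
  dz ψ₂ ζ + U * ψ₁ ζ = 0 ∧ -dzbar ψ₁ ζ + V * ψ₂ ζ = 0

/-- The potential `U` for mean curvature `H` and spinor value `(a, b)`, where `a b ≠ 0`. -/
def solU (H : ℝ) (a b : ℂ) : ℂ :=
  H / 2 * (‖a‖ ^ 2 + ‖b‖ ^ 2 : ℝ) - 1 / 2 * conj b ^ 2 * (conj a / a)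

/-- The potential `V` for mean curvature `H` and spinor value `(a, b)`, where `a b ≠ 0`. -/
def solV (H : ℝ) (a b : ℂ) : ℂ :=
  H / 2 * (‖a‖ ^ 2 + ‖b‖ ^ 2 : ℝ) + 1 / 2 * conj a ^ 2 * (conj b / b)

/-- The set where `Z₃ = ψ₁ ψ̄₂ ≠ 0`. -/
def regularSet (Ω : Set ℂ) (ψ₁ ψ₂ : ℂ → ℂ) : Set ℂ := {ζ ∈ Ω | ψ₁ ζ * conj (ψ₂ ζ) ≠ 0}

/-- The interior of the set where `Z₃ = ψ₁ ψ̄₂ = 0`. -/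
def flatSet (Ω : Set ℂ) (ψ₁ ψ₂ : ℂ → ℂ) : Set ℂ := interior {ζ ∈ Ω | ψ₁ ζ * conj (ψ₂ ζ) = 0}

/-- The Dirac equations of Sol: potentials `U`, `V` where `Z₃ ≠ 0`, zero potentials in the
interior of `{Z₃ = 0}`. -/
def SolDirac (Ω : Set ℂ) (H : ℂ → ℝ) (ψ₁ ψ₂ : ℂ → ℂ) : Prop :=
  (∀ ζ ∈ regularSet Ω ψ₁ ψ₂,
    DiracAt (solU (H ζ) (ψ₁ ζ) (ψ₂ ζ)) (solV (H ζ) (ψ₁ ζ) (ψ₂ ζ)) ψ₁ ψ₂ ζ) ∧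
  (∀ ζ ∈ flatSet Ω ψ₁ ψ₂, DiracAt 0 0 ψ₁ ψ₂ ζ)

/-! # Immersed surfaces -/

/-- A smooth immersion of a smooth surface into Sol (smoothness and the differential are those
of the map into the nine-dimensional space of matrices). -/
structure IsSurface {M : Type*} [TopologicalSpace M] [ChartedSpace ℂ M] (f : M → Sol) : Prop where
  smooth : ContMDiff 𝓘(ℝ, ℂ) 𝓘(ℝ, Fin 3 → Fin 3 → ℝ) ∞ (fun p i j => Sol.toMat (f p) i j)
  immersion : ∀ p : M, Function.Injective
    (mfderiv 𝓘(ℝ, ℂ) 𝓘(ℝ, Fin 3 → Fin 3 → ℝ) (fun p i j => Sol.toMat (f p) i j) p)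

/-- `F` is on the plane domain `D` a smooth immersion into Sol for which the parameter is
conformal. -/
structure IsConformalSurfaceOn (D : Set ℂ) (F : ℂ → Sol) : Prop where
  smooth : ContDiffOn ℝ ∞ (fun ζ (i j : Fin 3) => Sol.toMat (F ζ) i j) D
  immersion : ∀ ζ ∈ D, Function.Injective
    (fderiv ℝ (fun ζ (i j : Fin 3) => Sol.toMat (F ζ) i j) ζ)
  conformal : IsConformalOn D F

end

/-!
In the left-invariant frame a conformal immersion has a null complexified velocity `F_ζ`, and
`ψ ↦ Z` parametrizes the null vectors; the induced metric is `(|ψ₁|² + |ψ₂|²)² |dζ|²` and the unit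
normal is quadratic in `ψ` as well. The derivatives `∇_ζ F_ζ` and `∇_ζ̄ F_ζ` are linear in first
derivatives of `ψ` corrected by cubic terms that come from the connection. Since the connection is
torsion-free, `∇_ζ̄ F_ζ` is real, and it is normal in a conformal parameter. The reality of
`∇_ζ̄ F_ζ` is equivalent to the Dirac equation for some real `H`, which is then the mean curvature;
the normal component of `∇_ζ F_ζ` is the Hopf coefficient, and solving for `∂ψ` gives the Weingarten
equations. Equality of the mixed second derivatives of `ψ` gives the Codazzi equations.

Written without division by `ψ₁` and `ψ₂`, the Dirac equation makes sense at every point. In the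
converse it is only assumed on the union of `{Z₃ ≠ 0}` and the interior of `{Z₃ = 0}`, but this
union is dense, so that the reality of the would-be `∇_ζ̄ F_ζ` extends to `D` by continuity. In the
coordinates `F = (x, y, z)` it says that `Z₃ dζ`, `e^{-z} Z₁ dζ` and `e^z Z₂ dζ` have closed real
parts, whose primitives on the simply connected domain `D` give `z`, then `x` and `y`.
-/

noncomputable section

open scoped Topology

section Gluing

variable {X A : Type*} [TopologicalSpace X] [AddGroup A]

/-- Functions `f i` near each point `i` of `X`, given up to additive constants: any two of them
differ by a locally constant function on the intersection of their domains `U i` and `U j`. -/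
structure IsLocalPrimitiveFamily (U : X → Set X) (f : X → X → A) : Prop where
  isOpen : ∀ i, IsOpen (U i)
  mem : ∀ i, i ∈ U i
  sub_eventuallyEq : ∀ i j, ∀ x ∈ U i ∩ U j, ∀ᶠ y in 𝓝 x, f i y - f j y = f i x - f j x

namespace IsLocalPrimitiveFamily

variable {U : X → Set X} {f : X → X → A}

/-- The bundle over `X` with discrete fibre `A` whose transition functions are the differences
`f i - f j`; its sections are the functions that differ from every `f i` by a locally constant
function. -/
def bundleCore [TopologicalSpace A] [DiscreteTopology A] (h : IsLocalPrimitiveFamily U f) :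
    FiberBundleCore X X A where
  baseSet := U
  isOpen_baseSet := h.isOpen
  indexAt := id
  mem_baseSet_at := h.mem
  coordChange i j x a := a + (f i x - f j x)
  coordChange_self i x _ a := by simp
  continuousOn_coordChange i j := by
    rintro ⟨x, a⟩ ⟨hx, -⟩
    have hev : ∀ᶠ p : X × A in 𝓝 (x, a), p.2 + (f i p.1 - f j p.1) = a + (f i x - f j x) := by
      rw [nhds_prod_eq, nhds_discrete A]
      filter_upwards [(h.sub_eventuallyEq i j x hx).prod_mk
        (Filter.eventually_pure.2 rfl : ∀ᶠ b in pure a, b = a)] with p ⟨hsub, hp⟩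
      rw [hsub, hp]
    exact (continuousAt_const.congr (hev.mono fun _ hp => hp.symm)).continuousWithinAt
  coordChange_comp i j k x _ a := by simp [add_assoc]

/-- Functions given locally up to constants glue on a simply connected space: the gluing is a
section of a covering space. -/
theorem exists_eventuallyEq_const_add [SimplyConnectedSpace X] [LocallyPathConnectedSpace X]
    (h : IsLocalPrimitiveFamily U f) :
    ∃ g : X → A, ∀ x, ∃ c : A, ∀ᶠ y in 𝓝 x, g y = c + f x y := by
  let _ : TopologicalSpace A := ⊥
  have _ : DiscreteTopology A := ⟨rfl⟩
  let Z := h.bundleCore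
  have hcov : IsCoveringMap (Bundle.TotalSpace.proj : Z.TotalSpace → X) :=
    FiberBundle.isCoveringMap (F := A) (E := Z.Fiber)
  obtain ⟨x₀⟩ : Nonempty X := inferInstance
  obtain ⟨s, ⟨-, hs⟩, -⟩ := hcov.existsUnique_continuousMap_lifts (ContinuousMap.id X) x₀
    (⟨x₀, (0 : A)⟩ : Z.TotalSpace) rfl
  have hs_proj (x : X) : (s x).proj = x := congrFun hs x
  let val (x : X) : A := (s x).2
  refine ⟨fun y => val y + f y y, fun x => ⟨val x, ?_⟩⟩
  have htriv (y : X) : (Z.localTriv x (s y)).2 = val y + (f y y - f x y) := by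
    rw [Z.localTriv_apply]
    change val y + (f (s y).proj (s y).proj - f x (s y).proj) = _
    rw [hs_proj y]
  have hcont : ContinuousAt (fun y => (Z.localTriv x (s y)).2) x := by
    have hmem : s x ∈ (Z.localTriv x).source := by
      rw [(Z.localTriv x).mem_source]
      change (s x).proj ∈ U x
      rw [hs_proj x]
      exact h.mem x
    exact continuousAt_snd.comp
      (((Z.localTriv x).continuousAt hmem).comp (f := s) s.continuous.continuousAt)
  filter_upwards [hcont.eventually ((isOpen_discrete {(Z.localTriv x (s x)).2}).mem_nhds rfl)]
    with y hy
  have hval : val y + (f y y - f x y) = val x := by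
    rw [← htriv, Set.mem_singleton_iff.1 hy, htriv, sub_self, add_zero]
  rw [← hval, add_assoc, sub_add_cancel]

end IsLocalPrimitiveFamily

end Gluing

section Primitives

variable {E G : Type*} [NormedAddCommGroup E] [NormedSpace ℝ E] [NormedAddCommGroup G]
  [NormedSpace ℝ G] {D : Set E}

theorem sub_eventuallyEq_of_hasFDerivAt {f g : E → G} {η : E → E →L[ℝ] G} {s : Set E} {x : E}
    (hs : IsOpen s) (hx : x ∈ s) (hf : ∀ y ∈ s, HasFDerivAt f (η y) y)
    (hg : ∀ y ∈ s, HasFDerivAt g (η y) y) : ∀ᶠ y in 𝓝 x, f y - g y = f x - g x := by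
  have hsub (y : E) (hy : y ∈ s) : HasFDerivAt (fun y => f y - g y) (0 : E →L[ℝ] G) y := by
    simpa only [sub_self] using (hf y hy).fun_sub (hg y hy)
  obtain ⟨r, hr, hball⟩ := Metric.isOpen_iff.1 hs x hx
  filter_upwards [Metric.ball_mem_nhds x hr] with y hy
  exact Metric.isOpen_ball.is_const_of_fderiv_eq_zero (convex_ball x r).isPreconnected
    (fun w hw => (hsub w (hball hw)).differentiableAt.differentiableWithinAt)
    (fun w hw => (hsub w (hball hw)).fderiv) hy (Metric.mem_ball_self hr)

theorem exists_primitive_of_locally_exists_primitive [SimplyConnectedSpace D] (hD : IsOpen D)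
    {η : E → E →L[ℝ] G} (hloc : ∀ c ∈ D, ∃ U, IsOpen U ∧ c ∈ U ∧
      ∃ f : E → G, ∀ x ∈ U, HasFDerivAt f (η x) x) :
    ∃ f : E → G, ∀ x ∈ D, HasFDerivAt f (η x) x := by
  classical
  choose! U hU hmem f hf using hloc
  have : LocallyPathConnectedSpace D := hD.locallyPathConnectedSpace
  have hfam : IsLocalPrimitiveFamily (fun i : D => ((↑) : D → E) ⁻¹' U i)
      (fun i x : D => f i x) := by
    refine ⟨fun i => (hU i i.2).preimage continuous_subtype_val, fun i => hmem i i.2, ?_⟩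
    rintro i j x ⟨hxi, hxj⟩
    exact continuous_subtype_val.continuousAt.eventually <|
      sub_eventuallyEq_of_hasFDerivAt ((hU i i.2).inter (hU j j.2)) ⟨hxi, hxj⟩
        (fun y hy => hf i i.2 y hy.1) (fun y hy => hf j j.2 y hy.2)
  obtain ⟨g, hg⟩ := hfam.exists_eventuallyEq_const_add
  refine ⟨fun x => if h : x ∈ D then g ⟨x, h⟩ else 0, fun x hx => ?_⟩
  obtain ⟨c, hc⟩ := hg ⟨x, hx⟩
  refine ((hf x hx x (hmem x hx)).const_add c).congr_of_eventuallyEq ?_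
  rw [Filter.EventuallyEq, ← map_nhds_subtype_coe_eq_nhds hx (hD.mem_nhds hx),
    Filter.eventually_map]
  filter_upwards [hc] with y hy
  simp only [Subtype.coe_prop, dif_pos, hy]

theorem exists_primitive_of_fderiv_symmetric [SimplyConnectedSpace D] [CompleteSpace G]
    (hD : IsOpen D) {η : E → E →L[ℝ] G} (hη : DifferentiableOn ℝ η D)
    (hsymm : ∀ a ∈ D, ∀ x y, fderiv ℝ η a x y = fderiv ℝ η a y x) :
    ∃ f : E → G, ∀ x ∈ D, HasFDerivAt f (η x) x := by
  refine exists_primitive_of_locally_exists_primitive hD fun c hc => ?_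
  obtain ⟨r, hr, hball⟩ := Metric.isOpen_iff.1 hD c hc
  exact ⟨Metric.ball c r, Metric.isOpen_ball, Metric.mem_ball_self hr,
    (convex_ball c r).exists_forall_hasFDerivAt_of_fderiv_symmetric Metric.isOpen_ball
      (hη.mono hball) fun a ha => hsymm a (hball ha)⟩

end Primitives

section Wirtinger

/-- `u` is real differentiable at `ζ` with differential `p dζ + q dζ̄`. -/
def HasWirtingerDerivAt (u : ℂ → ℂ) (p q ζ : ℂ) : Prop :=
  HasFDerivAt u (p • (1 : ℂ →L[ℝ] ℂ) + q • (Complex.conjCLE : ℂ →L[ℝ] ℂ)) ζ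

variable {u v : ℂ → ℂ} {ζ p q p' q' : ℂ}

theorem map_eq_re_smul_add_im_smul {E : Type*} [NormedAddCommGroup E] [NormedSpace ℝ E]
    (L : ℂ →L[ℝ] E) (v : ℂ) : L v = v.re • L 1 + v.im • L Complex.I := by
  rw [← map_smul, ← map_smul, ← map_add]
  simp [Complex.re_add_im]

theorem fderiv_apply_eq_dz_add_dzbar (u : ℂ → ℂ) (ζ v : ℂ) :
    fderiv ℝ u ζ v = dz u ζ * v + dzbar u ζ * conj v := by
  rw [map_eq_re_smul_add_im_smul (fderiv ℝ u ζ) v, dz, dzbar]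
  apply Complex.ext <;> simp <;> ring

theorem hasWirtingerDerivAt_dz_dzbar (hu : DifferentiableAt ℝ u ζ) :
    HasWirtingerDerivAt u (dz u ζ) (dzbar u ζ) ζ := by
  refine hu.hasFDerivAt.congr_fderiv (ContinuousLinearMap.ext fun v => ?_)
  simp [fderiv_apply_eq_dz_add_dzbar u ζ v]

theorem hasWirtingerDerivAt_const (c ζ : ℂ) : HasWirtingerDerivAt (fun _ => c) 0 0 ζ :=
  (hasFDerivAt_const c ζ).congr_fderiv (by module)

theorem hasWirtingerDerivAt_ofReal {g : ℂ → ℝ} (hg : DifferentiableAt ℝ g ζ) :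
    HasWirtingerDerivAt (fun w => (g w : ℂ)) (dz (fun w => (g w : ℂ)) ζ)
      (dzbar (fun w => (g w : ℂ)) ζ) ζ :=
  hasWirtingerDerivAt_dz_dzbar (Complex.ofRealCLM.differentiableAt.comp ζ hg)

namespace HasWirtingerDerivAt

theorem dz_eq (hu : HasWirtingerDerivAt u p q ζ) : dz u ζ = p := by
  rw [dz, HasFDerivAt.fderiv hu]
  simp
  linear_combination (q - p) / 2 * Complex.I_sq

theorem dzbar_eq (hu : HasWirtingerDerivAt u p q ζ) : dzbar u ζ = q := by
  rw [dzbar, HasFDerivAt.fderiv hu]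
  simp
  linear_combination (p - q) / 2 * Complex.I_sq

theorem congr_deriv (hu : HasWirtingerDerivAt u p q ζ) (hp : p = p') (hq : q = q') :
    HasWirtingerDerivAt u p' q' ζ := hp ▸ hq ▸ hu

theorem add (hu : HasWirtingerDerivAt u p q ζ) (hv : HasWirtingerDerivAt v p' q' ζ) :
    HasWirtingerDerivAt (fun w => u w + v w) (p + p') (q + q') ζ :=
  (HasFDerivAt.fun_add hu hv).congr_fderiv (by module)

theorem sub (hu : HasWirtingerDerivAt u p q ζ) (hv : HasWirtingerDerivAt v p' q' ζ) :
    HasWirtingerDerivAt (fun w => u w - v w) (p - p') (q - q') ζ :=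
  (HasFDerivAt.fun_sub hu hv).congr_fderiv (by module)

theorem mul (hu : HasWirtingerDerivAt u p q ζ) (hv : HasWirtingerDerivAt v p' q' ζ) :
    HasWirtingerDerivAt (fun w => u w * v w) (p * v ζ + u ζ * p') (q * v ζ + u ζ * q') ζ :=
  (HasFDerivAt.fun_mul hu hv).congr_fderiv (by module)

theorem const_mul (c : ℂ) (hu : HasWirtingerDerivAt u p q ζ) :
    HasWirtingerDerivAt (fun w => c * u w) (c * p) (c * q) ζ :=
  ((hasWirtingerDerivAt_const c ζ).mul hu).congr_deriv (by ring) (by ring)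

theorem pow (n : ℕ) (hu : HasWirtingerDerivAt u p q ζ) :
    HasWirtingerDerivAt (fun w => u w ^ n) (n * u ζ ^ (n - 1) * p) (n * u ζ ^ (n - 1) * q) ζ :=
  (HasFDerivAt.pow hu n).congr_fderiv (by module)

theorem star (hu : HasWirtingerDerivAt u p q ζ) :
    HasWirtingerDerivAt (fun w => conj (u w)) (conj q) (conj p) ζ :=
  (Complex.conjCLE.hasFDerivAt.comp ζ hu).congr_fderiv
    (ContinuousLinearMap.ext fun v => by simp [add_comm])

theorem ofReal_comp {g : ℂ → ℝ} {φ : ℝ → ℝ} {φ' : ℝ}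
    (hg : HasWirtingerDerivAt (fun w => (g w : ℂ)) p q ζ) (hφ : HasDerivAt φ φ' (g ζ)) :
    HasWirtingerDerivAt (fun w => (φ (g w) : ℂ)) (φ' * p) (φ' * q) ζ := by
  have hre : HasFDerivAt g _ ζ := Complex.reCLM.hasFDerivAt.comp ζ hg
  have him (v : ℂ) : (p * v + q * conj v).im = 0 := by
    have h0 : HasFDerivAt (fun w => (g w : ℂ).im) _ ζ := Complex.imCLM.hasFDerivAt.comp ζ hg
    simp only [Complex.ofReal_im] at h0
    simpa using congrArg (fun L : ℂ →L[ℝ] ℝ => L v) (h0.unique (hasFDerivAt_const 0 ζ))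
  refine (Complex.ofRealCLM.hasFDerivAt.comp ζ (hφ.comp_hasFDerivAt ζ hre)).congr_fderiv
    (ContinuousLinearMap.ext fun v => ?_)
  apply Complex.ext
  · simp
    ring
  · have hv := him v
    simp at hv ⊢
    linear_combination -φ' * hv

theorem congr_of_eventuallyEq (hu : HasWirtingerDerivAt u p q ζ) (h : v =ᶠ[𝓝 ζ] u) :
    HasWirtingerDerivAt v p q ζ :=
  HasFDerivAt.congr_of_eventuallyEq hu h

end HasWirtingerDerivAt

theorem dz_conj (hu : DifferentiableAt ℝ u ζ) :
    dz (fun w => conj (u w)) ζ = conj (dzbar u ζ) :=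
  (hasWirtingerDerivAt_dz_dzbar hu).star.dz_eq

theorem dzbar_ofReal {g : ℂ → ℝ} (hg : DifferentiableAt ℝ g ζ) :
    dzbar (fun w => (g w : ℂ)) ζ = conj (dz (fun w => (g w : ℂ)) ζ) := by
  simpa only [Complex.conj_ofReal] using (hasWirtingerDerivAt_ofReal hg).star.dzbar_eq

section Smoothness

variable {Ω : Set ℂ}

theorem differentiableAt_of_contDiffOn {E F : Type*} [NormedAddCommGroup E] [NormedSpace ℝ E]
    [NormedAddCommGroup F] [NormedSpace ℝ F] {u : E → F} {s : Set E} (hs : IsOpen s)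
    (hu : ContDiffOn ℝ ∞ u s) {x : E} (hx : x ∈ s) : DifferentiableAt ℝ u x :=
  (hu.differentiableOn (by simp)).differentiableAt (hs.mem_nhds hx)

theorem contDiffOn_fderiv_apply {E : Type*} [NormedAddCommGroup E] [NormedSpace ℝ E] {u : ℂ → E}
    (hΩ : IsOpen Ω) (hu : ContDiffOn ℝ ∞ u Ω) (v : ℂ) :
    ContDiffOn ℝ ∞ (fun w => fderiv ℝ u w v) Ω :=
  (hu.fderiv_of_isOpen hΩ (by simp)).clm_apply contDiffOn_const

theorem contDiffOn_dz (hΩ : IsOpen Ω) (hu : ContDiffOn ℝ ∞ u Ω) : ContDiffOn ℝ ∞ (dz u) Ω :=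
  ((contDiffOn_fderiv_apply hΩ hu 1).sub
    (contDiffOn_const.mul (contDiffOn_fderiv_apply hΩ hu Complex.I))).div_const 2

theorem contDiffOn_dzbar (hΩ : IsOpen Ω) (hu : ContDiffOn ℝ ∞ u Ω) :
    ContDiffOn ℝ ∞ (dzbar u) Ω :=
  ((contDiffOn_fderiv_apply hΩ hu 1).add
    (contDiffOn_const.mul (contDiffOn_fderiv_apply hΩ hu Complex.I))).div_const 2

theorem contDiffOn_conj (hu : ContDiffOn ℝ ∞ u Ω) : ContDiffOn ℝ ∞ (fun w => conj (u w)) Ω :=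
  Complex.conjCLE.contDiff.comp_contDiffOn hu

theorem contDiffOn_re (hu : ContDiffOn ℝ ∞ u Ω) : ContDiffOn ℝ ∞ (fun w => (u w).re) Ω :=
  Complex.reCLM.contDiff.comp_contDiffOn hu

theorem contDiffOn_ofReal {g : ℂ → ℝ} (hg : ContDiffOn ℝ ∞ g Ω) :
    ContDiffOn ℝ ∞ (fun w => (g w : ℂ)) Ω :=
  Complex.ofRealCLM.contDiff.comp_contDiffOn hg

theorem dzbar_dz_comm (hΩ : IsOpen Ω) (hu : ContDiffOn ℝ ∞ u Ω) (hζ : ζ ∈ Ω) :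
    dzbar (dz u) ζ = dz (dzbar u) ζ := by
  have hsymm : fderiv ℝ (fderiv ℝ u) ζ 1 Complex.I = fderiv ℝ (fderiv ℝ u) ζ Complex.I 1 :=
    ((hu.contDiffAt (hΩ.mem_nhds hζ)).isSymmSndFDerivAt
      (minSmoothness_of_isRCLikeNormedField.trans_le (WithTop.coe_le_coe.2 le_top))).eq 1 Complex.I
  have hd : DifferentiableAt ℝ (fderiv ℝ u) ζ :=
    differentiableAt_of_contDiffOn hΩ (hu.fderiv_of_isOpen hΩ (by simp)) hζ
  have happly (v : ℂ) : HasFDerivAt (fun w => fderiv ℝ u w v)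
      ((fderiv ℝ (fderiv ℝ u) ζ).flip v) ζ := by
    simpa using hd.hasFDerivAt.clm_apply (hasFDerivAt_const v ζ)
  have hdz : HasFDerivAt (dz u) _ ζ :=
    ((happly 1).fun_sub ((happly Complex.I).const_mul Complex.I)).mul_const 2⁻¹
  have hdzbar : HasFDerivAt (dzbar u) _ ζ :=
    ((happly 1).fun_add ((happly Complex.I).const_mul Complex.I)).mul_const 2⁻¹
  rw [dzbar, dz, hdz.fderiv, hdzbar.fderiv]
  simp [hsymm]
  ring

end Smoothness

/-- `∂̄u` is real exactly when the real form `u dζ + ū dζ̄` is closed. -/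
theorem exists_hasWirtingerDerivAt_ofReal {D : Set ℂ} [SimplyConnectedSpace D] (hD : IsOpen D)
    (hu : ContDiffOn ℝ ∞ u D) (hclosed : ∀ ζ ∈ D, (dzbar u ζ).im = 0) (P : ℂ) (c : ℝ) :
    ∃ f : ℂ → ℝ, f P = c ∧ ContDiffOn ℝ ∞ f D ∧
      ∀ ζ ∈ D, HasWirtingerDerivAt (fun w => (f w : ℂ)) (u ζ) (conj (u ζ)) ζ := by
  let Λ : ℂ →L[ℝ] ℂ →L[ℝ] ℝ :=
    (2 : ℝ) • (ContinuousLinearMap.compL ℝ ℂ ℂ ℝ Complex.reCLM) ∘L ContinuousLinearMap.mul ℝ ℂ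
  have hΛ (a b : ℂ) : Λ a b = 2 * (a * b).re := by simp [Λ]
  have hη : ContDiffOn ℝ ∞ (fun ζ => Λ (u ζ)) D := Λ.contDiff.comp_contDiffOn hu
  have hsymm : ∀ a ∈ D, ∀ x y, fderiv ℝ (fun ζ => Λ (u ζ)) a x y =
      fderiv ℝ (fun ζ => Λ (u ζ)) a y x := by
    intro a ha x y
    have hd := Λ.hasFDerivAt.comp a (differentiableAt_of_contDiffOn hD hu ha).hasFDerivAt
    rw [show fderiv ℝ (fun ζ => Λ (u ζ)) a = _ from hd.fderiv]
    simp only [ContinuousLinearMap.comp_apply, hΛ, fderiv_apply_eq_dz_add_dzbar u a]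
    have hq := hclosed a ha
    simp [hq]
    ring
  obtain ⟨f, hf⟩ := exists_primitive_of_fderiv_symmetric hD (hη.differentiableOn (by simp)) hsymm
  refine ⟨fun ζ => f ζ - f P + c, by ring, ?_, fun ζ hζ => ?_⟩
  · have hsmooth : ContDiffOn ℝ ∞ f D := by
      rw [contDiffOn_infty_iff_fderiv_of_isOpen hD]
      exact ⟨fun ζ hζ => (hf ζ hζ).differentiableAt.differentiableWithinAt,
        hη.congr fun ζ hζ => (hf ζ hζ).fderiv⟩
    exact (hsmooth.sub contDiffOn_const).add contDiffOn_const
  · refine (Complex.ofRealCLM.hasFDerivAt.comp ζ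
      (((hf ζ hζ).sub_const (f P)).add_const c)).congr_fderiv
      (ContinuousLinearMap.ext fun v => ?_)
    apply Complex.ext <;> simp [hΛ] <;> ring

end Wirtinger

section SolGeometry

namespace Sol

/-- The element of Sol with coordinates `(x, y, z)`. -/
def ofCoords (x y z : ℝ) : Sol :=
  ⟨Matrix.GeneralLinearGroup.mkOfDetNeZero (solMatrix x y z)
    (by simp [solMatrix, Matrix.det_fin_three, ← Real.exp_add]), x, y, z, rfl⟩

theorem toMat_ofCoords (x y z : ℝ) : toMat (ofCoords x y z) = solMatrix x y z := rfl

theorem exists_eq_ofCoords (g : Sol) : ∃ x y z, g = ofCoords x y z := by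
  obtain ⟨g, x, y, z, h⟩ := g
  exact ⟨x, y, z, Subtype.ext (Units.ext h)⟩

theorem toMat_inv_mul_toMat (g : Sol) : toMat g⁻¹ * toMat g = 1 :=
  (g : GL (Fin 3) ℝ).inv_mul

theorem toMat_mul_toMat_inv (g : Sol) : toMat g * toMat g⁻¹ = 1 :=
  (g : GL (Fin 3) ℝ).mul_inv

theorem exists_contDiffOn_coords {Ω : Set ℂ} {F : ℂ → Sol}
    (hF : ContDiffOn ℝ ∞ (fun ζ (i j : Fin 3) => toMat (F ζ) i j) Ω) :
    ∃ x y z : ℂ → ℝ, ContDiffOn ℝ ∞ x Ω ∧ ContDiffOn ℝ ∞ y Ω ∧ ContDiffOn ℝ ∞ z Ω ∧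
      F = fun ζ => ofCoords (x ζ) (y ζ) (z ζ) := by
  choose x y z h using fun ζ => exists_eq_ofCoords (F ζ)
  have entry (i j : Fin 3) : ContDiffOn ℝ ∞ (fun ζ => solMatrix (x ζ) (y ζ) (z ζ) i j) Ω := by
    simpa only [h, toMat_ofCoords] using contDiffOn_pi.1 (contDiffOn_pi.1 hF i) j
  refine ⟨x, y, z, entry 0 2, entry 1 2, ?_, funext h⟩
  have hlog := (entry 1 1).log fun ζ _ => (Real.exp_pos (z ζ)).ne'
  exact hlog.congr fun ζ _ => (Real.log_exp (z ζ)).symm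

theorem contDiffOn_ofCoords {Ω : Set ℂ} {x y z : ℂ → ℝ} (hx : ContDiffOn ℝ ∞ x Ω)
    (hy : ContDiffOn ℝ ∞ y Ω) (hz : ContDiffOn ℝ ∞ z Ω) :
    ContDiffOn ℝ ∞ (fun ζ (i j : Fin 3) => toMat (ofCoords (x ζ) (y ζ) (z ζ)) i j) Ω := by
  refine contDiffOn_pi.2 fun i => contDiffOn_pi.2 fun j => ?_
  simp only [toMat_ofCoords]
  have hexp := hz.exp
  have hexp_neg := hz.neg.exp
  fin_cases i <;> fin_cases j <;> simp [solMatrix, contDiffOn_const, hx, hy, hexp, hexp_neg]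

end Sol

variable {Ω : Set ℂ} {F : ℂ → Sol} {ζ : ℂ}

theorem leftDeriv_eq_iff {v : ℂ} {X : Matrix (Fin 3) (Fin 3) ℝ} : leftDeriv F v ζ = X ↔
    Matrix.of (fun i j => fderiv ℝ (fun w => Sol.toMat (F w) i j) ζ v) =
      Sol.toMat (F ζ) * X := by
  constructor
  · rintro rfl
    rw [leftDeriv, ← mul_assoc, Sol.toMat_mul_toMat_inv, one_mul]
  · intro h
    rw [leftDeriv, h, ← mul_assoc, Sol.toMat_inv_mul_toMat, one_mul]

theorem leftDeriv_ofCoords (x y : ℂ → ℝ) {z : ℂ → ℝ} (hz : DifferentiableAt ℝ z ζ) (v : ℂ) :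
    leftDeriv (fun w => Sol.ofCoords (x w) (y w) (z w)) v ζ =
      ∑ k, (![Real.exp (z ζ) * fderiv ℝ x ζ v, Real.exp (-z ζ) * fderiv ℝ y ζ v,
        fderiv ℝ z ζ v] : Fin 3 → ℝ) k • solBasis k := by
  rw [leftDeriv_eq_iff]
  have hexp := hz.hasFDerivAt.exp.fderiv
  have hexpneg := hz.hasFDerivAt.fun_neg.exp.fderiv
  ext i j
  fin_cases i <;> fin_cases j <;>
    simp [Sol.toMat_ofCoords, solMatrix, Fin.sum_univ_three, solBasis, Matrix.mul_apply, hexp,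
      hexpneg, ← mul_assoc, ← Real.exp_add]

theorem velocity_ofCoords (x y : ℂ → ℝ) {z : ℂ → ℝ} (hz : DifferentiableAt ℝ z ζ) (v : ℂ) :
    velocity (fun w => Sol.ofCoords (x w) (y w) (z w)) v ζ =
      ![Real.exp (z ζ) * fderiv ℝ x ζ v, Real.exp (-z ζ) * fderiv ℝ y ζ v, fderiv ℝ z ζ v] := by
  rw [velocity, leftDeriv_ofCoords x y hz, solCoord_sum]

theorem leftDeriv_eq_sum_velocity (hΩ : IsOpen Ω)
    (hF : ContDiffOn ℝ ∞ (fun ζ (i j : Fin 3) => Sol.toMat (F ζ) i j) Ω) (hζ : ζ ∈ Ω) (v : ℂ) :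
    leftDeriv F v ζ = ∑ k, velocity F v ζ k • solBasis k := by
  obtain ⟨x, y, z, -, -, hz, rfl⟩ := Sol.exists_contDiffOn_coords hF
  have hz' := differentiableAt_of_contDiffOn hΩ hz hζ
  rw [leftDeriv_ofCoords x y hz', velocity_ofCoords x y hz']

theorem velocity_eq_zero_iff (hΩ : IsOpen Ω)
    (hF : ContDiffOn ℝ ∞ (fun ζ (i j : Fin 3) => Sol.toMat (F ζ) i j) Ω) (hζ : ζ ∈ Ω) {v : ℂ} :
    velocity F v ζ = 0 ↔ fderiv ℝ (fun ζ (i j : Fin 3) => Sol.toMat (F ζ) i j) ζ v = 0 := by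
  have hentry (i j : Fin 3) : fderiv ℝ (fun ζ (i j : Fin 3) => Sol.toMat (F ζ) i j) ζ v i j =
      fderiv ℝ (fun w => Sol.toMat (F w) i j) ζ v := by
    have hd := (differentiableAt_of_contDiffOn hΩ hF hζ).hasFDerivAt
    rw [(hasFDerivAt_pi'.1 (hasFDerivAt_pi'.1 hd i) j).fderiv]
    rfl
  have hmat : Matrix.of (fun i j => fderiv ℝ (fun w => Sol.toMat (F w) i j) ζ v) = 0 ↔
      fderiv ℝ (fun ζ (i j : Fin 3) => Sol.toMat (F ζ) i j) ζ v = 0 := by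
    simp only [← hentry]
    exact Iff.rfl
  rw [← hmat]
  constructor
  · intro h
    rw [← mul_zero (Sol.toMat (F ζ)), ← leftDeriv_eq_iff, leftDeriv_eq_sum_velocity hΩ hF hζ, h]
    simp
  · intro h
    rw [velocity, leftDeriv, h, mul_zero]
    ext k
    fin_cases k <;> rfl

end SolGeometry

section ComplexVelocity

/-- The bilinear map `Γ` for which `∇_X Y = ∂_X Y + Γ(X, Y)` in the left-invariant frame of Sol,
over any commutative ring so that it also applies to complexified tangent vectors. -/
def christoffel {R : Type*} [CommRing R] (X Y : Fin 3 → R) : Fin 3 → R :=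
  ![X 0 * Y 2, -(X 1 * Y 2), X 1 * Y 1 - X 0 * Y 0]

theorem covDeriv_apply (F : ℂ → Sol) (V : ℂ → Fin 3 → ℝ) (v ζ : ℂ) (i : Fin 3) :
    covDeriv F V v ζ i =
      fderiv ℝ (fun w => V w i) ζ v + christoffel (velocity F v ζ) (V ζ) i := by
  rw [covDeriv, add_right_inj]
  fin_cases i <;>
    simp [christoffel, Fin.sum_univ_three, solConn, solAlpha, solCoord, solBasis, Ring.lie_def,
      Matrix.mul_apply]
  ring

/-- The components of `F_ζ = (F_x - i F_y) / 2` in the left-invariant frame. -/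
def velocityDz (F : ℂ → Sol) (ζ : ℂ) : Fin 3 → ℂ := fun k =>
  (velocity F 1 ζ k - Complex.I * velocity F Complex.I ζ k) / 2

/-- The components of `∇_ζ F_ζ`, where `Z` are the components of `F_ζ`. -/
def covDz (Z : ℂ → Fin 3 → ℂ) (ζ : ℂ) : Fin 3 → ℂ := fun k =>
  dz (fun w => Z w k) ζ + christoffel (Z ζ) (Z ζ) k

/-- The components of `∇_ζ̄ F_ζ`, where `Z` are the components of `F_ζ`. -/
def covDzbar (Z : ℂ → Fin 3 → ℂ) (ζ : ℂ) : Fin 3 → ℂ := fun k =>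
  dzbar (fun w => Z w k) ζ + christoffel (star (Z ζ)) (Z ζ) k

variable {Ω : Set ℂ} {F : ℂ → Sol} {ζ : ℂ}

theorem velocity_eq_re_smul_add_im_smul (F : ℂ → Sol) (v ζ : ℂ) :
    velocity F v ζ = v.re • velocity F 1 ζ + v.im • velocity F Complex.I ζ := by
  have hmat : leftDeriv F v ζ = v.re • leftDeriv F 1 ζ + v.im • leftDeriv F Complex.I ζ := by
    simp only [leftDeriv, ← Matrix.mul_smul, ← mul_add]
    congr 1
    ext i j
    exact map_eq_re_smul_add_im_smul _ v
  ext k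
  rw [velocity, hmat]
  fin_cases k <;> rfl

theorem velocity_eq_re_velocityDz (F : ℂ → Sol) (v ζ : ℂ) (k : Fin 3) :
    velocity F v ζ k = 2 * (v * velocityDz F ζ k).re := by
  rw [velocity_eq_re_smul_add_im_smul F v ζ]
  simp [velocityDz]
  ring

theorem leftDz_eq_sum_velocityDz (hΩ : IsOpen Ω)
    (hF : ContDiffOn ℝ ∞ (fun ζ (i j : Fin 3) => Sol.toMat (F ζ) i j) Ω) (hζ : ζ ∈ Ω) :
    leftDz F ζ = ∑ k, velocityDz F ζ k • (solBasis k).map Complex.ofReal := by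
  rw [leftDz, leftDeriv_eq_sum_velocity hΩ hF hζ, leftDeriv_eq_sum_velocity hΩ hF hζ]
  ext i j
  simp [Fin.sum_univ_three, velocityDz]
  ring

theorem leftDz_eq_sum_iff (hΩ : IsOpen Ω)
    (hF : ContDiffOn ℝ ∞ (fun ζ (i j : Fin 3) => Sol.toMat (F ζ) i j) Ω) (hζ : ζ ∈ Ω)
    {Z : Fin 3 → ℂ} :
    leftDz F ζ = ∑ k, Z k • (solBasis k).map Complex.ofReal ↔ velocityDz F ζ = Z := by
  rw [leftDz_eq_sum_velocityDz hΩ hF hζ]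
  refine ⟨fun h => ?_, fun h => by rw [h]⟩
  ext k
  fin_cases k
  · simpa [Fin.sum_univ_three, solBasis] using congrFun (congrFun h 0) 2
  · simpa [Fin.sum_univ_three, solBasis] using congrFun (congrFun h 1) 2
  · simpa [Fin.sum_univ_three, solBasis] using congrFun (congrFun h 1) 1

theorem covDeriv_velocity {k : Fin 3}
    (hZ : DifferentiableAt ℝ (fun w => velocityDz F w k) ζ) (v w : ℂ) :
    covDeriv F (velocity F w) v ζ k =
      2 * (w * (v * covDz (velocityDz F) ζ k + conj v * covDzbar (velocityDz F) ζ k)).re := by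
  have hderiv : fderiv ℝ (fun x => velocity F w x k) ζ v =
      2 * (w * (v * dz (fun x => velocityDz F x k) ζ +
        conj v * dzbar (fun x => velocityDz F x k) ζ)).re := by
    simp only [velocity_eq_re_velocityDz F w]
    have h := (Complex.reCLM.hasFDerivAt.comp ζ (hZ.hasFDerivAt.const_mul w)).const_mul 2
    rw [show fderiv ℝ (fun x => 2 * (w * velocityDz F x k).re) ζ = _ from h.fderiv]
    simp [fderiv_apply_eq_dz_add_dzbar]
    ring
  rw [covDeriv_apply, hderiv]
  fin_cases k <;>
    simp [christoffel, covDz, covDzbar, velocity_eq_re_velocityDz] <;> ring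

theorem secondForm_eq (hZ : ∀ k, DifferentiableAt ℝ (fun w => velocityDz F w k) ζ) (v w : ℂ) :
    secondForm F v w ζ =
      2 * (w * (v * (covDz (velocityDz F) ζ ⬝ᵥ fun k => (unitNormal F ζ k : ℂ)) +
        conj v * (covDzbar (velocityDz F) ζ ⬝ᵥ fun k => (unitNormal F ζ k : ℂ)))).re := by
  simp only [secondForm, dotProduct, Fin.sum_univ_three, covDeriv_velocity (hZ _)]
  simp
  ring

theorem hopfCoeff_eq_covDz_dotProduct
    (hZ : ∀ k, DifferentiableAt ℝ (fun w => velocityDz F w k) ζ) :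
    hopfCoeff F ζ = covDz (velocityDz F) ζ ⬝ᵥ fun k => (unitNormal F ζ k : ℂ) := by
  simp only [hopfCoeff, secondForm_eq hZ]
  apply Complex.ext <;> simp <;> ring

theorem meanCurvature_mul_firstForm (hZ : ∀ k, DifferentiableAt ℝ (fun w => velocityDz F w k) ζ)
    (hne : firstForm F 1 1 ζ ≠ 0) :
    meanCurvature F ζ * firstForm F 1 1 ζ =
      2 * (covDzbar (velocityDz F) ζ ⬝ᵥ fun k => (unitNormal F ζ k : ℂ)).re := by
  rw [meanCurvature, mul_comm (2 : ℝ), ← div_div, div_right_comm, div_mul_cancel₀ _ hne,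
    secondForm_eq hZ, secondForm_eq hZ]
  simp
  ring

theorem firstForm_eq (F : ℂ → Sol) (v w ζ : ℂ) : firstForm F v w ζ =
    2 * (v * w * (velocityDz F ζ ⬝ᵥ velocityDz F ζ) +
      v * conj w * (velocityDz F ζ ⬝ᵥ star (velocityDz F ζ))).re := by
  simp only [firstForm, dotProduct, Fin.sum_univ_three, velocity_eq_re_velocityDz F v,
    velocity_eq_re_velocityDz F w]
  simp
  ring

theorem crossProduct_velocity (F : ℂ → Sol) (ζ : ℂ) (k : Fin 3) :
    (crossProduct (velocity F 1 ζ) (velocity F Complex.I ζ) k : ℂ) =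
      -2 * Complex.I * crossProduct (velocityDz F ζ) (star (velocityDz F ζ)) k := by
  fin_cases k <;> apply Complex.ext <;> simp [crossProduct, velocity_eq_re_velocityDz] <;> ring

theorem dz_ofReal {g : ℂ → ℝ} (hg : DifferentiableAt ℝ g ζ) :
    dz (fun w => (g w : ℂ)) ζ =
      (fderiv ℝ g ζ 1 - Complex.I * fderiv ℝ g ζ Complex.I) / 2 := by
  have h : fderiv ℝ (fun w => (g w : ℂ)) ζ = _ :=
    (Complex.ofRealCLM.hasFDerivAt.comp ζ hg.hasFDerivAt).fderiv
  rw [dz, h]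
  rfl

theorem velocityDz_ofCoords {x y z : ℂ → ℝ} (hx : DifferentiableAt ℝ x ζ)
    (hy : DifferentiableAt ℝ y ζ) (hz : DifferentiableAt ℝ z ζ) :
    velocityDz (fun w => Sol.ofCoords (x w) (y w) (z w)) ζ =
      ![Real.exp (z ζ) * dz (fun w => (x w : ℂ)) ζ, Real.exp (-z ζ) * dz (fun w => (y w : ℂ)) ζ,
        dz (fun w => (z w : ℂ)) ζ] := by
  ext k
  simp only [velocityDz, velocity_ofCoords x y hz, dz_ofReal hx, dz_ofReal hy, dz_ofReal hz]
  fin_cases k <;> simp <;> ring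

end ComplexVelocity

section Integrability

variable {Ω : Set ℂ} {F : ℂ → Sol} {ζ : ℂ}

theorem im_dzbar_dz_ofReal (hΩ : IsOpen Ω) {g : ℂ → ℝ} (hg : ContDiffOn ℝ ∞ g Ω) (hζ : ζ ∈ Ω) :
    (dzbar (dz fun w => (g w : ℂ)) ζ).im = 0 := by
  have hgC := contDiffOn_ofReal hg
  have hconj : (fun w => conj (dz (fun x => (g x : ℂ)) w)) =ᶠ[𝓝 ζ] dzbar fun x => (g x : ℂ) := by
    filter_upwards [hΩ.mem_nhds hζ] with w hw
    exact (dzbar_ofReal (differentiableAt_of_contDiffOn hΩ hg hw)).symm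
  rw [← Complex.conj_eq_iff_im,
    ← dz_conj (differentiableAt_of_contDiffOn hΩ (contDiffOn_dz hΩ hgC) hζ), dz,
    hconj.fderiv_eq, dzbar_dz_comm hΩ hgC hζ, dz]

theorem dzbar_exp_mul {z : ℂ → ℝ} {u : ℂ → ℂ} {p : ℂ} (s : ℝ)
    (hz : HasWirtingerDerivAt (fun w => (z w : ℂ)) p (conj p) ζ) (hu : DifferentiableAt ℝ u ζ) :
    dzbar (fun w => (Real.exp (s * z w) : ℂ) * u w) ζ =
      Real.exp (s * z ζ) * (s * conj p * u ζ + dzbar u ζ) := by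
  have hexp : HasDerivAt (fun t => Real.exp (s * t)) (Real.exp (s * z ζ) * s) (z ζ) := by
    simpa using ((hasDerivAt_id (z ζ)).const_mul s).exp
  rw [((hz.ofReal_comp hexp).mul (hasWirtingerDerivAt_dz_dzbar hu)).dzbar_eq]
  push_cast
  ring

theorem contDiffOn_velocityDz (hΩ : IsOpen Ω)
    (hF : ContDiffOn ℝ ∞ (fun ζ (i j : Fin 3) => Sol.toMat (F ζ) i j) Ω) (k : Fin 3) :
    ContDiffOn ℝ ∞ (fun ζ => velocityDz F ζ k) Ω := by
  obtain ⟨x, y, z, hx, hy, hz, rfl⟩ := Sol.exists_contDiffOn_coords hF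
  have hd {g : ℂ → ℝ} (hg : ContDiffOn ℝ ∞ g Ω) {ζ : ℂ} (hζ : ζ ∈ Ω) : DifferentiableAt ℝ g ζ :=
    differentiableAt_of_contDiffOn hΩ hg hζ
  refine ContDiffOn.congr ?_ fun ζ hζ =>
    congrFun (velocityDz_ofCoords (hd hx hζ) (hd hy hζ) (hd hz hζ)) k
  fin_cases k
  · exact (contDiffOn_ofReal hz.exp).mul (contDiffOn_dz hΩ (contDiffOn_ofReal hx))
  · exact (contDiffOn_ofReal hz.neg.exp).mul (contDiffOn_dz hΩ (contDiffOn_ofReal hy))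
  · exact contDiffOn_dz hΩ (contDiffOn_ofReal hz)

/-- `e^{-z}Z₁`, `e^zZ₂` and `Z₃` are the derivatives of the coordinates `x`, `y`, `z` of Sol. -/
theorem im_covDzbar_eq_zero_iff {Z : ℂ → Fin 3 → ℂ} {z : ℂ → ℝ}
    (hZ : ∀ k, DifferentiableAt ℝ (fun w => Z w k) ζ)
    (hz : HasWirtingerDerivAt (fun w => (z w : ℂ)) (Z ζ 2) (conj (Z ζ 2)) ζ) :
    (∀ k, (covDzbar Z ζ k).im = 0) ↔
      (dzbar (fun w => (Real.exp (-1 * z w) : ℂ) * Z w 0) ζ).im = 0 ∧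
        (dzbar (fun w => (Real.exp (1 * z w) : ℂ) * Z w 1) ζ).im = 0 ∧
          (dzbar (fun w => Z w 2) ζ).im = 0 := by
  have h0 : (covDzbar Z ζ 0).im =
      ((-1 : ℝ) * conj (Z ζ 2) * Z ζ 0 + dzbar (fun w => Z w 0) ζ).im := by
    simp [covDzbar, christoffel]
    ring
  have h1 : (covDzbar Z ζ 1).im =
      ((1 : ℝ) * conj (Z ζ 2) * Z ζ 1 + dzbar (fun w => Z w 1) ζ).im := by
    simp [covDzbar, christoffel]
    ring
  have h2 : (covDzbar Z ζ 2).im = (dzbar (fun w => Z w 2) ζ).im := by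
    simp [covDzbar, christoffel]
    ring
  rw [dzbar_exp_mul _ hz (hZ 0), dzbar_exp_mul _ hz (hZ 1), Complex.im_ofReal_mul,
    Complex.im_ofReal_mul, mul_eq_zero_iff_left (Real.exp_pos _).ne',
    mul_eq_zero_iff_left (Real.exp_pos _).ne', Fin.forall_fin_succ, Fin.forall_fin_two, ← h0,
    ← h1, ← h2]
  rfl

/-- Torsion-freeness: `∇_ζ̄ F_ζ` and its conjugate `∇_ζ F_ζ̄` agree. -/
theorem im_covDzbar_velocityDz (hΩ : IsOpen Ω)
    (hF : ContDiffOn ℝ ∞ (fun ζ (i j : Fin 3) => Sol.toMat (F ζ) i j) Ω) (hζ : ζ ∈ Ω) :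
    ∀ k, (covDzbar (velocityDz F) ζ k).im = 0 := by
  have hZ (k : Fin 3) : DifferentiableAt ℝ (fun w => velocityDz F w k) ζ :=
    differentiableAt_of_contDiffOn hΩ (contDiffOn_velocityDz hΩ hF k) hζ
  obtain ⟨x, y, z, hx, hy, hz, rfl⟩ := Sol.exists_contDiffOn_coords hF
  have hd {g : ℂ → ℝ} (hg : ContDiffOn ℝ ∞ g Ω) {ζ : ℂ} (hζ : ζ ∈ Ω) : DifferentiableAt ℝ g ζ :=
    differentiableAt_of_contDiffOn hΩ hg hζ
  have hveloc {w : ℂ} (hw : w ∈ Ω) :=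
    velocityDz_ofCoords (hd hx hw) (hd hy hw) (hd hz hw)
  have im_dzbar_eq_zero {u : ℂ → ℂ} {g : ℂ → ℝ} (hg : ContDiffOn ℝ ∞ g Ω)
      (hu : ∀ w ∈ Ω, u w = dz (fun w => (g w : ℂ)) w) : (dzbar u ζ).im = 0 := by
    rw [← im_dzbar_dz_ofReal hΩ hg hζ, dzbar, dzbar,
      Filter.EventuallyEq.fderiv_eq (Filter.eventually_of_mem (hΩ.mem_nhds hζ) hu)]
  refine (im_covDzbar_eq_zero_iff (z := z) hZ ?_).2
    ⟨im_dzbar_eq_zero hx fun w hw => ?_, im_dzbar_eq_zero hy fun w hw => ?_,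
      im_dzbar_eq_zero hz fun w hw => congrFun (hveloc hw) 2⟩
  · refine (hasWirtingerDerivAt_ofReal (hd hz hζ)).congr_deriv ?_ ?_
    · rw [hveloc hζ]; rfl
    · rw [hveloc hζ, dzbar_ofReal (hd hz hζ)]; rfl
  · rw [hveloc hw, neg_one_mul]
    simp [← mul_assoc, ← Complex.exp_add]
  · rw [hveloc hw, one_mul]
    simp [← mul_assoc, ← Complex.exp_add]

/-- Converse of torsion-freeness: `z`, then `x` and `y`, are found by integration. -/
theorem exists_velocityDz_eq {D : Set ℂ} [SimplyConnectedSpace D] (hD : IsOpen D)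
    {Z : ℂ → Fin 3 → ℂ} (hZ : ∀ k, ContDiffOn ℝ ∞ (fun ζ => Z ζ k) D)
    (him : ∀ ζ ∈ D, ∀ k, (covDzbar Z ζ k).im = 0) (P : ℂ) (g : Sol) :
    ∃ F : ℂ → Sol, F P = g ∧
      ContDiffOn ℝ ∞ (fun ζ (i j : Fin 3) => Sol.toMat (F ζ) i j) D ∧
      ∀ ζ ∈ D, velocityDz F ζ = Z ζ := by
  obtain ⟨x₀, y₀, z₀, rfl⟩ := Sol.exists_eq_ofCoords g
  have hZd (ζ) (hζ : ζ ∈ D) (k : Fin 3) : DifferentiableAt ℝ (fun w => Z w k) ζ :=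
    differentiableAt_of_contDiffOn hD (hZ k) hζ
  obtain ⟨z, hzP, hz, hz'⟩ := exists_hasWirtingerDerivAt_ofReal hD (hZ 2) (fun ζ hζ => by
    rw [← him ζ hζ 2]
    simp [covDzbar, christoffel]
    ring) P z₀
  have him' (ζ) (hζ : ζ ∈ D) := (im_covDzbar_eq_zero_iff (hZd ζ hζ) (hz' ζ hζ)).1 (him ζ hζ)
  have hexp (s : ℝ) : ContDiffOn ℝ ∞ (fun w => (Real.exp (s * z w) : ℂ)) D :=
    contDiffOn_ofReal (contDiffOn_const.mul hz).exp
  obtain ⟨x, hxP, hx, hx'⟩ := exists_hasWirtingerDerivAt_ofReal hD ((hexp (-1)).mul (hZ 0))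
    (fun ζ hζ => (him' ζ hζ).1) P x₀
  obtain ⟨y, hyP, hy, hy'⟩ := exists_hasWirtingerDerivAt_ofReal hD ((hexp 1).mul (hZ 1))
    (fun ζ hζ => (him' ζ hζ).2.1) P y₀
  refine ⟨fun ζ => Sol.ofCoords (x ζ) (y ζ) (z ζ), by simp only [hxP, hyP, hzP],
    Sol.contDiffOn_ofCoords hx hy hz, fun ζ hζ => ?_⟩
  rw [velocityDz_ofCoords (differentiableAt_of_contDiffOn hD hx hζ)
    (differentiableAt_of_contDiffOn hD hy hζ) (differentiableAt_of_contDiffOn hD hz hζ),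
    (hx' ζ hζ).dz_eq, (hy' ζ hζ).dz_eq, (hz' ζ hζ).dz_eq]
  ext k
  fin_cases k <;> simp [← mul_assoc, ← Complex.exp_add]

end Integrability

section SpinorAlgebra

/-- The squared length `|a|² + |b|²` of a spinor; it is the conformal factor `e^α` of the surface
the spinor generates. -/
def spinorSq (a b : ℂ) : ℝ := ‖a‖ ^ 2 + ‖b‖ ^ 2

/-- The normal vector determined by a spinor `(a, b)`, of length `|a|² + |b|²`. -/
def spinorNormal (a b : ℂ) : Fin 3 → ℝ :=
  ![-2 * (a * b).im, -2 * (a * b).re, ‖b‖ ^ 2 - ‖a‖ ^ 2]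

/-- The derivative of `spinorVec a b` for the variation `p` of `a` and `c` of `conj b`. -/
def spinorVecDeriv (a b p c : ℂ) : Fin 3 → ℂ :=
  ![Complex.I * (conj b * c + a * p), conj b * c - a * p, a * c + conj b * p]

theorem spinorSq_pos {a b : ℂ} (h : a ≠ 0 ∨ b ≠ 0) : 0 < spinorSq a b := by
  unfold spinorSq
  rcases h with h | h <;> have := norm_pos_iff.2 h <;> positivity

theorem ofReal_spinorSq (a b : ℂ) : (spinorSq a b : ℂ) = a * conj a + b * conj b := by
  rw [Complex.mul_conj', Complex.mul_conj', spinorSq]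
  push_cast
  rfl

theorem ofReal_spinorNormal (a b : ℂ) : (fun k => (spinorNormal a b k : ℂ)) =
    ![Complex.I * (a * b - conj a * conj b), -(a * b + conj a * conj b),
      b * conj b - a * conj a] := by
  ext k
  rw [Complex.mul_conj', Complex.mul_conj']
  fin_cases k
  · apply Complex.ext <;> simp [spinorNormal]
    ring
  · apply Complex.ext <;> simp [spinorNormal] <;> ring
  · simp [spinorNormal]

theorem spinorVec_dotProduct_self (a b : ℂ) : spinorVec a b ⬝ᵥ spinorVec a b = 0 := by
  simp only [dotProduct, Fin.sum_univ_three, spinorVec, Matrix.cons_val]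
  linear_combination (1 / 4) * (conj b ^ 2 + a ^ 2) ^ 2 * Complex.I_sq

theorem star_spinorVec (a b : ℂ) : star (spinorVec a b) =
    ![-(Complex.I / 2 * (b ^ 2 + conj a ^ 2)), 1 / 2 * (b ^ 2 - conj a ^ 2), conj a * b] := by
  ext k
  fin_cases k <;> simp [spinorVec]
  ring

theorem spinorVec_dotProduct_star (a b : ℂ) :
    spinorVec a b ⬝ᵥ star (spinorVec a b) = spinorSq a b ^ 2 / 2 := by
  rw [star_spinorVec, ofReal_spinorSq]
  simp only [dotProduct, Fin.sum_univ_three, spinorVec, Matrix.cons_val]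
  linear_combination -(1 / 4) * (conj b ^ 2 + a ^ 2) * (b ^ 2 + conj a ^ 2) * Complex.I_sq

theorem crossProduct_spinorVec_star (a b : ℂ) (k : Fin 3) :
    crossProduct (spinorVec a b) (star (spinorVec a b)) k =
      Complex.I / 2 * (spinorSq a b * spinorNormal a b k) := by
  rw [congrFun (ofReal_spinorNormal a b) k, star_spinorVec, ofReal_spinorSq, cross_apply]
  fin_cases k <;> simp only [spinorVec, Fin.zero_eta, Fin.mk_one, Fin.reduceFinMk, Matrix.cons_val]
  · linear_combination
      -(1 / 2) * (a * conj a + b * conj b) * (a * b - conj a * conj b) * Complex.I_sq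
  · ring
  · ring

theorem spinorNormal_dotProduct_self (a b : ℂ) :
    spinorNormal a b ⬝ᵥ spinorNormal a b = spinorSq a b ^ 2 := by
  simp only [dotProduct, Fin.sum_univ_three, spinorNormal, spinorSq, Matrix.cons_val,
    Complex.sq_norm, Complex.normSq_apply, Complex.mul_re, Complex.mul_im]
  ring

theorem christoffel_spinorVec (a b : ℂ) : christoffel (spinorVec a b) (spinorVec a b) =
    spinorVecDeriv a b (1 / 2 * conj b ^ 3) (1 / 2 * a ^ 3) := by
  ext k
  fin_cases k <;>
    simp only [christoffel, spinorVec, spinorVecDeriv, Fin.zero_eta, Fin.mk_one, Fin.reduceFinMk,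
      Matrix.cons_val]
  · ring
  · ring
  · linear_combination -(1 / 4) * (conj b ^ 2 + a ^ 2) ^ 2 * Complex.I_sq

theorem christoffel_star_spinorVec (a b : ℂ) :
    christoffel (star (spinorVec a b)) (spinorVec a b) =
      spinorVecDeriv a b (-(1 / 2 * conj a ^ 2 * conj b)) (-(1 / 2 * a * b ^ 2)) := by
  rw [star_spinorVec]
  ext k
  fin_cases k <;>
    simp only [christoffel, spinorVec, spinorVecDeriv, Fin.zero_eta, Fin.mk_one, Fin.reduceFinMk,
      Matrix.cons_val]
  · ring
  · ring
  · linear_combination (1 / 4) * (conj b ^ 2 + a ^ 2) * (b ^ 2 + conj a ^ 2) * Complex.I_sq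

theorem spinorVecDeriv_add (a b p c p' c' : ℂ) : spinorVecDeriv a b p c + spinorVecDeriv a b p' c' =
    spinorVecDeriv a b (p + p') (c + c') := by
  ext k
  fin_cases k <;> simp [spinorVecDeriv] <;> ring

theorem spinorVecDeriv_dotProduct_spinorNormal (a b p c : ℂ) :
    (spinorVecDeriv a b p c ⬝ᵥ fun k => (spinorNormal a b k : ℂ)) =
      spinorSq a b * (conj b * p - a * c) := by
  rw [ofReal_spinorNormal, ofReal_spinorSq]
  simp only [dotProduct, Fin.sum_univ_three, spinorVecDeriv, Matrix.cons_val]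
  linear_combination (conj b * c + a * p) * (a * b - conj a * conj b) * Complex.I_sq

/-- `(ā, b)` and `(b̄, -a)` are orthogonal vectors of squared length `|a|² + |b|²`, so that they
form a frame in which any `(p, c)` can be expanded. -/
theorem spinorSq_mul_eq (a b p c : ℂ) :
    spinorSq a b * p = conj a * (a * p + b * c) + b * (conj b * p - conj a * c) ∧
      spinorSq a b * c = conj b * (a * p + b * c) - a * (conj b * p - conj a * c) := by
  rw [ofReal_spinorSq]
  constructor <;> ring

theorem im_spinorVecDeriv_eq_zero_iff (a b p c : ℂ) :
    (∀ k, (spinorVecDeriv a b p c k).im = 0) ↔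
      a * p + b * conj c = 0 ∧ (conj b * p - conj a * conj c).im = 0 := by
  have h₀ : (spinorVecDeriv a b p c 0).im = (a * p + b * conj c).re := by
    simp [spinorVecDeriv]
    ring
  have h₁ : (spinorVecDeriv a b p c 1).im = -(a * p + b * conj c).im := by
    simp [spinorVecDeriv]
    ring
  have h₂ : (spinorVecDeriv a b p c 2).im = (conj b * p - conj a * conj c).im := by
    simp [spinorVecDeriv]
    ring
  rw [Complex.ext_iff, Fin.forall_fin_succ, Fin.forall_fin_two]
  simp only [Fin.succ_zero_eq_one, Fin.succ_one_eq_two, h₀, h₁, h₂, neg_eq_zero, Complex.zero_re,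
    Complex.zero_im, and_assoc]

theorem im_spinorVecDeriv_eq_zero_iff_exists {a b : ℂ} (h : a ≠ 0 ∨ b ≠ 0) (p c : ℂ) :
    (∀ k, (spinorVecDeriv a b p c k).im = 0) ↔ ∃ g : ℝ, p = g * b ∧ c = -g * conj a := by
  have hr : (spinorSq a b : ℂ) ≠ 0 := by exact_mod_cast (spinorSq_pos h).ne'
  rw [im_spinorVecDeriv_eq_zero_iff]
  constructor
  · rintro ⟨htangent, hreal⟩
    obtain ⟨hp, hc⟩ := spinorSq_mul_eq a b p (conj c)
    set t : ℝ := (conj b * p - conj a * conj c).re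
    have ht : conj b * p - conj a * conj c = t := Complex.ext rfl hreal
    rw [htangent, ht] at hp hc
    have hc' : conj c = -(t / spinorSq a b) * a := by
      field_simp
      linear_combination hc
    refine ⟨t / spinorSq a b, ?_, ?_⟩ <;> push_cast
    · field_simp
      linear_combination hp
    · simpa using congrArg conj hc'
  · rintro ⟨g, rfl, rfl⟩
    have hnormal : conj b * (g * b) - conj a * conj (-g * conj a) = (g * spinorSq a b : ℝ) := by
      push_cast
      rw [ofReal_spinorSq]
      simp
      ring
    refine ⟨?_, by rw [hnormal, Complex.ofReal_im]⟩
    simp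
    ring

end SpinorAlgebra

section SpinorSurfaces

variable {Ω : Set ℂ} {F : ℂ → Sol} {ψ₁ ψ₂ : ℂ → ℂ} {ζ : ℂ}

theorem hasWirtingerDerivAt_spinorVec {p q p' q' : ℂ} (h₁ : HasWirtingerDerivAt ψ₁ p q ζ)
    (h₂ : HasWirtingerDerivAt (fun w => conj (ψ₂ w)) p' q' ζ) (k : Fin 3) :
    HasWirtingerDerivAt (fun w => spinorVec (ψ₁ w) (ψ₂ w) k)
      (spinorVecDeriv (ψ₁ ζ) (ψ₂ ζ) p p' k) (spinorVecDeriv (ψ₁ ζ) (ψ₂ ζ) q q' k) ζ := by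
  fin_cases k
  · refine (((h₂.pow 2).add (h₁.pow 2)).const_mul (Complex.I / 2)).congr_deriv ?_ ?_ <;>
    · simp only [spinorVecDeriv, Fin.zero_eta, Matrix.cons_val]
      push_cast
      ring
  · refine (((h₂.pow 2).sub (h₁.pow 2)).const_mul (1 / 2)).congr_deriv ?_ ?_ <;>
    · simp only [spinorVecDeriv, Fin.mk_one, Matrix.cons_val]
      push_cast
      ring
  · refine (h₁.mul h₂).congr_deriv ?_ ?_ <;>
    · simp only [spinorVecDeriv, Fin.reduceFinMk, Matrix.cons_val]
      ring

theorem covDz_spinorVec (h₁ : DifferentiableAt ℝ ψ₁ ζ) (h₂ : DifferentiableAt ℝ ψ₂ ζ) :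
    covDz (fun w => spinorVec (ψ₁ w) (ψ₂ w)) ζ = spinorVecDeriv (ψ₁ ζ) (ψ₂ ζ)
      (dz ψ₁ ζ + 1 / 2 * conj (ψ₂ ζ) ^ 3)
      (dz (fun w => conj (ψ₂ w)) ζ + 1 / 2 * ψ₁ ζ ^ 3) := by
  rw [← spinorVecDeriv_add, ← christoffel_spinorVec]
  ext k
  rw [dz_conj h₂]
  exact congrArg (· + _) (hasWirtingerDerivAt_spinorVec (hasWirtingerDerivAt_dz_dzbar h₁)
    (hasWirtingerDerivAt_dz_dzbar h₂).star k).dz_eq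

theorem covDzbar_spinorVec (h₁ : DifferentiableAt ℝ ψ₁ ζ) (h₂ : DifferentiableAt ℝ ψ₂ ζ) :
    covDzbar (fun w => spinorVec (ψ₁ w) (ψ₂ w)) ζ = spinorVecDeriv (ψ₁ ζ) (ψ₂ ζ)
      (dzbar ψ₁ ζ - 1 / 2 * conj (ψ₁ ζ) ^ 2 * conj (ψ₂ ζ))
      (conj (dz ψ₂ ζ) - 1 / 2 * ψ₁ ζ * ψ₂ ζ ^ 2) := by
  rw [sub_eq_add_neg, sub_eq_add_neg, ← spinorVecDeriv_add, ← christoffel_star_spinorVec]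
  ext k
  exact congrArg (· + _) (hasWirtingerDerivAt_spinorVec (hasWirtingerDerivAt_dz_dzbar h₁)
    (hasWirtingerDerivAt_dz_dzbar h₂).star k).dzbar_eq

theorem covDz_congr {Z Z' : ℂ → Fin 3 → ℂ} (h : Z =ᶠ[𝓝 ζ] Z') : covDz Z ζ = covDz Z' ζ := by
  ext k
  have hk : (fun w => Z w k) =ᶠ[𝓝 ζ] fun w => Z' w k := h.fun_comp (· k)
  simp only [covDz, dz, hk.fderiv_eq, h.eq_of_nhds]

theorem covDzbar_congr {Z Z' : ℂ → Fin 3 → ℂ} (h : Z =ᶠ[𝓝 ζ] Z') :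
    covDzbar Z ζ = covDzbar Z' ζ := by
  ext k
  have hk : (fun w => Z w k) =ᶠ[𝓝 ζ] fun w => Z' w k := h.fun_comp (· k)
  simp only [covDzbar, dzbar, hk.fderiv_eq, h.eq_of_nhds]

/-- The Dirac equation written without dividing by `ψ₁` and `ψ₂`, so that it makes sense on the
whole domain. -/
def RegularDiracAt (H : ℝ) (ψ₁ ψ₂ : ℂ → ℂ) (ζ : ℂ) : Prop :=
  dzbar ψ₁ ζ = H / 2 * spinorSq (ψ₁ ζ) (ψ₂ ζ) * ψ₂ ζ
      + 1 / 2 * conj (ψ₁ ζ) ^ 2 * conj (ψ₂ ζ) ∧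
    dz ψ₂ ζ = -(H / 2 * spinorSq (ψ₁ ζ) (ψ₂ ζ)) * ψ₁ ζ
      + 1 / 2 * conj (ψ₂ ζ) ^ 2 * conj (ψ₁ ζ)

theorem diracAt_iff_regularDiracAt {H : ℝ} (h₁ : ψ₁ ζ ≠ 0) (h₂ : ψ₂ ζ ≠ 0) :
    DiracAt (solU H (ψ₁ ζ) (ψ₂ ζ)) (solV H (ψ₁ ζ) (ψ₂ ζ)) ψ₁ ψ₂ ζ ↔
      RegularDiracAt H ψ₁ ψ₂ ζ := by
  have hU : solU H (ψ₁ ζ) (ψ₂ ζ) * ψ₁ ζ = H / 2 * spinorSq (ψ₁ ζ) (ψ₂ ζ) * ψ₁ ζ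
      - 1 / 2 * conj (ψ₂ ζ) ^ 2 * conj (ψ₁ ζ) := by
    rw [solU, spinorSq]
    field_simp
  have hV : solV H (ψ₁ ζ) (ψ₂ ζ) * ψ₂ ζ = H / 2 * spinorSq (ψ₁ ζ) (ψ₂ ζ) * ψ₂ ζ
      + 1 / 2 * conj (ψ₁ ζ) ^ 2 * conj (ψ₂ ζ) := by
    rw [solV, spinorSq]
    field_simp
  rw [DiracAt, RegularDiracAt, hU, hV]
  constructor
  · rintro ⟨h, h'⟩
    exact ⟨by linear_combination -h', by linear_combination h⟩
  · rintro ⟨h, h'⟩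
    exact ⟨by linear_combination h', by linear_combination -h⟩

theorem im_covDzbar_spinorVec_eq_zero_iff (h₁ : DifferentiableAt ℝ ψ₁ ζ)
    (h₂ : DifferentiableAt ℝ ψ₂ ζ) (hne : ψ₁ ζ ≠ 0 ∨ ψ₂ ζ ≠ 0) :
    (∀ k, (covDzbar (fun w => spinorVec (ψ₁ w) (ψ₂ w)) ζ k).im = 0) ↔
      ∃ H : ℝ, RegularDiracAt H ψ₁ ψ₂ ζ := by
  have hr := (spinorSq_pos hne).ne'
  rw [covDzbar_spinorVec h₁ h₂, im_spinorVecDeriv_eq_zero_iff_exists hne]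
  constructor
  · rintro ⟨g, hp, hc⟩
    have hc' := congrArg conj hc
    simp only [map_sub, map_mul, map_pow, map_neg, map_div₀, map_one, map_ofNat, Complex.conj_conj,
      Complex.conj_ofReal] at hc'
    refine ⟨2 * g / spinorSq (ψ₁ ζ) (ψ₂ ζ), ?_⟩
    have hg : ((2 * g / spinorSq (ψ₁ ζ) (ψ₂ ζ) : ℝ) : ℂ) / 2 * spinorSq (ψ₁ ζ) (ψ₂ ζ) = g := by
      norm_cast
      field_simp
    rw [RegularDiracAt, hg]
    exact ⟨by linear_combination hp, by linear_combination hc'⟩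
  · rintro ⟨H, hp, hc⟩
    refine ⟨H / 2 * spinorSq (ψ₁ ζ) (ψ₂ ζ), ?_, ?_⟩ <;> push_cast
    · linear_combination hp
    · rw [hc]
      simp only [map_add, map_mul, map_pow, map_neg, map_div₀, map_one, map_ofNat,
        Complex.conj_conj, Complex.conj_ofReal]
      ring

/-- A smooth map into Sol on an open set of the plane, with a generating spinor without zeros: a
conformally immersed surface in a chart. -/
structure SpinorSurface (Ω : Set ℂ) (F : ℂ → Sol) (ψ₁ ψ₂ : ℂ → ℂ) : Prop where
  isOpen : IsOpen Ω
  smooth : ContDiffOn ℝ ∞ (fun ζ (i j : Fin 3) => Sol.toMat (F ζ) i j) Ω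
  generating : IsGeneratingSpinor Ω F ψ₁ ψ₂
  ne_zero : ∀ ζ ∈ Ω, ψ₁ ζ ≠ 0 ∨ ψ₂ ζ ≠ 0

namespace SpinorSurface

variable (h : SpinorSurface Ω F ψ₁ ψ₂)
include h

theorem differentiableAt₁ (hζ : ζ ∈ Ω) : DifferentiableAt ℝ ψ₁ ζ :=
  differentiableAt_of_contDiffOn h.isOpen h.generating.smooth₁ hζ

theorem differentiableAt₂ (hζ : ζ ∈ Ω) : DifferentiableAt ℝ ψ₂ ζ :=
  differentiableAt_of_contDiffOn h.isOpen h.generating.smooth₂ hζ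

theorem ofReal_spinorSq_ne_zero (hζ : ζ ∈ Ω) : (spinorSq (ψ₁ ζ) (ψ₂ ζ) : ℂ) ≠ 0 := by
  exact_mod_cast (spinorSq_pos (h.ne_zero ζ hζ)).ne'

theorem velocityDz_eq (hζ : ζ ∈ Ω) : velocityDz F ζ = spinorVec (ψ₁ ζ) (ψ₂ ζ) :=
  (leftDz_eq_sum_iff h.isOpen h.smooth hζ).1 (h.generating.eq ζ hζ)

theorem velocityDz_eventuallyEq (hζ : ζ ∈ Ω) :
    velocityDz F =ᶠ[𝓝 ζ] fun w => spinorVec (ψ₁ w) (ψ₂ w) := by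
  filter_upwards [h.isOpen.mem_nhds hζ] with w hw using h.velocityDz_eq hw

theorem differentiableAt_velocityDz (hζ : ζ ∈ Ω) (k : Fin 3) :
    DifferentiableAt ℝ (fun w => velocityDz F w k) ζ :=
  differentiableAt_of_contDiffOn h.isOpen (contDiffOn_velocityDz h.isOpen h.smooth k) hζ

theorem firstForm_eq (hζ : ζ ∈ Ω) (v w : ℂ) :
    firstForm F v w ζ = (v * conj w).re * spinorSq (ψ₁ ζ) (ψ₂ ζ) ^ 2 := by
  rw [_root_.firstForm_eq, h.velocityDz_eq hζ, spinorVec_dotProduct_self,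
    spinorVec_dotProduct_star, mul_zero, zero_add, ← Complex.ofReal_pow,
    show ((2 : ℂ) = (2 : ℝ)) from rfl, ← Complex.ofReal_div, Complex.re_mul_ofReal]
  ring

theorem firstForm_one_one (hζ : ζ ∈ Ω) : firstForm F 1 1 ζ = spinorSq (ψ₁ ζ) (ψ₂ ζ) ^ 2 := by
  simp [h.firstForm_eq hζ]

theorem isConformalOn : IsConformalOn Ω F := fun ζ hζ => by
  simp [h.firstForm_eq hζ]

theorem unitNormal_eq (hζ : ζ ∈ Ω) : unitNormal F ζ =
    (spinorSq (ψ₁ ζ) (ψ₂ ζ))⁻¹ • spinorNormal (ψ₁ ζ) (ψ₂ ζ) := by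
  have hr := spinorSq_pos (h.ne_zero ζ hζ)
  set r := spinorSq (ψ₁ ζ) (ψ₂ ζ) with hr_def
  set n := spinorNormal (ψ₁ ζ) (ψ₂ ζ) with hn_def
  have hcross : crossProduct (velocity F 1 ζ) (velocity F Complex.I ζ) = r • n := by
    ext k
    have hk := crossProduct_velocity F ζ k
    rw [h.velocityDz_eq hζ, crossProduct_spinorVec_star, ← hr_def, ← hn_def] at hk
    apply Complex.ofReal_injective
    rw [Pi.smul_apply, smul_eq_mul, Complex.ofReal_mul, hk]
    linear_combination -(r * n k : ℂ) * Complex.I_sq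
  have hnorm : (r • n) ⬝ᵥ (r • n) = (r ^ 2) ^ 2 := by
    rw [smul_dotProduct, dotProduct_smul, spinorNormal_dotProduct_self, smul_eq_mul, smul_eq_mul]
    ring
  simp only [unitNormal, hcross]
  rw [hnorm, Real.sqrt_sq (by positivity), smul_smul]
  congr 1
  field_simp

theorem spinorVecDeriv_dotProduct_unitNormal (hζ : ζ ∈ Ω) (p c : ℂ) :
    (spinorVecDeriv (ψ₁ ζ) (ψ₂ ζ) p c ⬝ᵥ fun k => (unitNormal F ζ k : ℂ)) =
      conj (ψ₂ ζ) * p - ψ₁ ζ * c := by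
  have hN : (fun k => (unitNormal F ζ k : ℂ)) = (spinorSq (ψ₁ ζ) (ψ₂ ζ) : ℂ)⁻¹ •
      fun k => (spinorNormal (ψ₁ ζ) (ψ₂ ζ) k : ℂ) := by
    ext k
    simp [h.unitNormal_eq hζ]
  rw [hN, dotProduct_smul, spinorVecDeriv_dotProduct_spinorNormal, smul_eq_mul,
    inv_mul_cancel_left₀ (h.ofReal_spinorSq_ne_zero hζ)]

theorem hopfCoeff_eq (hζ : ζ ∈ Ω) : hopfCoeff F ζ =
    (conj (ψ₂ ζ) * dz ψ₁ ζ - ψ₁ ζ * dz (fun w => conj (ψ₂ w)) ζ)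
      + 1 / 2 * (conj (ψ₂ ζ) ^ 4 - ψ₁ ζ ^ 4) := by
  rw [hopfCoeff_eq_covDz_dotProduct (h.differentiableAt_velocityDz hζ),
    covDz_congr (h.velocityDz_eventuallyEq hζ),
    covDz_spinorVec (h.differentiableAt₁ hζ) (h.differentiableAt₂ hζ),
    h.spinorVecDeriv_dotProduct_unitNormal hζ]
  ring

theorem meanCurvature_mul_spinorSq_sq (hζ : ζ ∈ Ω) :
    meanCurvature F ζ * spinorSq (ψ₁ ζ) (ψ₂ ζ) ^ 2 =
      2 * (conj (ψ₂ ζ) * (dzbar ψ₁ ζ - 1 / 2 * conj (ψ₁ ζ) ^ 2 * conj (ψ₂ ζ)) -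
        ψ₁ ζ * (conj (dz ψ₂ ζ) - 1 / 2 * ψ₁ ζ * ψ₂ ζ ^ 2)).re := by
  have hne : firstForm F 1 1 ζ ≠ 0 := by
    rw [h.firstForm_one_one hζ]
    exact (pow_pos (spinorSq_pos (h.ne_zero ζ hζ)) 2).ne'
  rw [← h.firstForm_one_one hζ,
    meanCurvature_mul_firstForm (h.differentiableAt_velocityDz hζ) hne,
    covDzbar_congr (h.velocityDz_eventuallyEq hζ),
    covDzbar_spinorVec (h.differentiableAt₁ hζ) (h.differentiableAt₂ hζ),
    h.spinorVecDeriv_dotProduct_unitNormal hζ]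

theorem eq_meanCurvature_of_regularDiracAt (hζ : ζ ∈ Ω) {H : ℝ}
    (hH : RegularDiracAt H ψ₁ ψ₂ ζ) : meanCurvature F ζ = H := by
  have hr := spinorSq_pos (h.ne_zero ζ hζ)
  apply mul_right_cancel₀ (pow_pos hr 2).ne'
  have hreal : conj (ψ₂ ζ) * (dzbar ψ₁ ζ - 1 / 2 * conj (ψ₁ ζ) ^ 2 * conj (ψ₂ ζ)) -
      ψ₁ ζ * (conj (dz ψ₂ ζ) - 1 / 2 * ψ₁ ζ * ψ₂ ζ ^ 2) =
        (H / 2 * spinorSq (ψ₁ ζ) (ψ₂ ζ) ^ 2 : ℝ) := by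
    rw [hH.1, hH.2]
    simp only [map_add, map_mul, map_pow, map_neg, map_div₀, map_one, map_ofNat,
      Complex.conj_conj, Complex.conj_ofReal]
    push_cast
    rw [ofReal_spinorSq]
    ring
  rw [h.meanCurvature_mul_spinorSq_sq hζ, hreal, Complex.ofReal_re]
  ring

theorem regularDiracAt (hζ : ζ ∈ Ω) : RegularDiracAt (meanCurvature F ζ) ψ₁ ψ₂ ζ := by
  have him := im_covDzbar_velocityDz h.isOpen h.smooth hζ
  rw [covDzbar_congr (h.velocityDz_eventuallyEq hζ), im_covDzbar_spinorVec_eq_zero_iff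
    (h.differentiableAt₁ hζ) (h.differentiableAt₂ hζ) (h.ne_zero ζ hζ)] at him
  obtain ⟨H, hH⟩ := him
  rwa [h.eq_meanCurvature_of_regularDiracAt hζ hH]

theorem eventuallyEq_zero_of_mem_flatSet (hζ : ζ ∈ flatSet Ω ψ₁ ψ₂) :
    ψ₁ =ᶠ[𝓝 ζ] 0 ∨ ψ₂ =ᶠ[𝓝 ζ] 0 := by
  have hev : ∀ᶠ w in 𝓝 ζ, ψ₁ w = 0 ∨ ψ₂ w = 0 := by
    filter_upwards [mem_interior_iff_mem_nhds.1 hζ] with w hw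
    simpa using hw.2
  have hζΩ : ζ ∈ Ω := (interior_subset hζ).1
  rcases h.ne_zero ζ hζΩ with h₁ | h₂
  · right
    filter_upwards [hev, (h.differentiableAt₁ hζΩ).continuousAt.eventually_ne h₁] with w hw hw₁
      using hw.resolve_left hw₁
  · left
    filter_upwards [hev, (h.differentiableAt₂ hζΩ).continuousAt.eventually_ne h₂] with w hw hw₂
      using hw.resolve_right hw₂

theorem solDirac : SolDirac Ω (meanCurvature F) ψ₁ ψ₂ := by
  refine ⟨fun ζ hζ => ?_, fun ζ hζ => ?_⟩
  · obtain ⟨hζΩ, hne⟩ := hζ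
    rw [mul_ne_zero_iff, map_ne_zero] at hne
    exact (diracAt_iff_regularDiracAt hne.1 hne.2).2 (h.regularDiracAt hζΩ)
  · obtain ⟨hdzbar, hdz⟩ := h.regularDiracAt (interior_subset hζ).1
    rcases h.eventuallyEq_zero_of_mem_flatSet hζ with h₁ | h₂
    · have hψ₁ : dzbar ψ₁ ζ = 0 := by simp [dzbar, h₁.fderiv_eq]
      have hψ₂ : dz ψ₂ ζ = 0 := by simp [hdz, h₁.eq_of_nhds]
      simp [DiracAt, hψ₁, hψ₂]
    · have hψ₁ : dzbar ψ₁ ζ = 0 := by simp [hdzbar, h₂.eq_of_nhds]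
      have hψ₂ : dz ψ₂ ζ = 0 := by simp [dz, h₂.fderiv_eq]
      simp [DiracAt, hψ₁, hψ₂]

end SpinorSurface

end SpinorSurfaces

section WeingartenCodazzi

/-- Equality of the mixed second derivatives of `a` and of `b`, each of which is a linear
combination of the two compatibility conditions with coefficients forming an invertible matrix. -/
theorem compatibility_of_weingarten {Ω : Set ℂ} (hΩ : IsOpen Ω) {a b σ β : ℂ → ℂ} {g : ℂ → ℝ}
    (ha : ContDiffOn ℝ ∞ a Ω) (hb : ContDiffOn ℝ ∞ b Ω)
    (hda : ∀ w ∈ Ω, HasWirtingerDerivAt a (σ w * a w + β w * b w - 1 / 2 * conj (b w) ^ 3)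
      (g w * b w + 1 / 2 * (conj (a w) ^ 2 * conj (b w))) w)
    (hdb : ∀ w ∈ Ω, HasWirtingerDerivAt b (1 / 2 * (conj (b w) ^ 2 * conj (a w)) - g w * a w)
      (conj (σ w) * b w - conj (β w) * a w - 1 / 2 * conj (a w) ^ 3) w)
    {ζ : ℂ} (hζ : ζ ∈ Ω) (hne : a ζ ≠ 0 ∨ b ζ ≠ 0) {σ' β' g' K B : ℂ}
    (hσ : HasWirtingerDerivAt σ σ' K ζ) (hK : conj K = K) (hβ : HasWirtingerDerivAt β β' B ζ)
    (hg : HasWirtingerDerivAt (fun w => (g w : ℂ)) g' (conj g') ζ) :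
    K - β ζ * conj (β ζ) + g ζ ^ 2 =
        1 / 4 * (6 * (a ζ * conj (a ζ)) * (b ζ * conj (b ζ)) -
          ((a ζ * conj (a ζ)) ^ 2 + (b ζ * conj (b ζ)) ^ 2)) ∧
      B + β ζ * conj (σ ζ) - g' + g ζ * σ ζ =
        (b ζ * conj (b ζ) - a ζ * conj (a ζ)) * (a ζ * conj (b ζ)) := by
  have haζ := hda ζ hζ
  have hbζ := hdb ζ hζ
  have hdz_a := (((hσ.mul haζ).add (hβ.mul hbζ)).sub
    ((hbζ.star.pow 3).const_mul (1 / 2))).congr_of_eventuallyEq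
    ((hΩ.eventually_mem hζ).mono fun w hw => (hda w hw).dz_eq)
  have hdzbar_a := ((hg.mul hbζ).add
    (((haζ.star.pow 2).mul hbζ.star).const_mul (1 / 2))).congr_of_eventuallyEq
    ((hΩ.eventually_mem hζ).mono fun w hw => (hda w hw).dzbar_eq)
  have hdz_b := ((((hbζ.star.pow 2).mul haζ.star).const_mul (1 / 2)).sub
    (hg.mul haζ)).congr_of_eventuallyEq
    ((hΩ.eventually_mem hζ).mono fun w hw => (hdb w hw).dz_eq)
  have hdzbar_b := (((hσ.star.mul hbζ).sub (hβ.star.mul haζ)).sub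
    ((haζ.star.pow 3).const_mul (1 / 2))).congr_of_eventuallyEq
    ((hΩ.eventually_mem hζ).mono fun w hw => (hdb w hw).dzbar_eq)
  have hmixed_a := hdz_a.dzbar_eq.symm.trans ((dzbar_dz_comm hΩ ha hζ).trans hdzbar_a.dz_eq)
  have hmixed_b := congrArg conj
    (hdz_b.dzbar_eq.symm.trans ((dzbar_dz_comm hΩ hb hζ).trans hdzbar_b.dz_eq))
  simp only [map_add, map_sub, map_mul, map_pow, map_div₀, map_one, map_ofNat, map_natCast,
    Complex.conj_conj, Complex.conj_ofReal, hK] at hmixed_a hmixed_b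
  push_cast at hmixed_a hmixed_b
  have hr : (spinorSq (a ζ) (b ζ) : ℂ) ≠ 0 := by exact_mod_cast (spinorSq_pos hne).ne'
  constructor <;> apply mul_left_cancel₀ hr <;> rw [ofReal_spinorSq]
  · linear_combination conj (a ζ) * hmixed_a - b ζ * hmixed_b
  · linear_combination conj (b ζ) * hmixed_a + a ζ * hmixed_b

namespace SpinorSurface

variable {Ω : Set ℂ} {F : ℂ → Sol} {ψ₁ ψ₂ : ℂ → ℂ} {ζ : ℂ} (h : SpinorSurface Ω F ψ₁ ψ₂)
include h

theorem logFactor_eq (hζ : ζ ∈ Ω) : logFactor F ζ = Real.log (spinorSq (ψ₁ ζ) (ψ₂ ζ)) := by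
  rw [logFactor, h.firstForm_one_one hζ, Real.log_pow]
  push_cast
  ring

theorem exp_logFactor (hζ : ζ ∈ Ω) : Real.exp (logFactor F ζ) = spinorSq (ψ₁ ζ) (ψ₂ ζ) := by
  rw [h.logFactor_eq hζ, Real.exp_log (spinorSq_pos (h.ne_zero ζ hζ))]

theorem contDiffOn_spinorSq : ContDiffOn ℝ ∞ (fun w => spinorSq (ψ₁ w) (ψ₂ w)) Ω :=
  (h.generating.smooth₁.norm_sq ℝ).add (h.generating.smooth₂.norm_sq ℝ)

theorem contDiffOn_logFactor : ContDiffOn ℝ ∞ (logFactor F) Ω :=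
  (h.contDiffOn_spinorSq.log fun w hw => (spinorSq_pos (h.ne_zero w hw)).ne').congr
    fun _ hw => h.logFactor_eq hw

theorem contDiffOn_hopfCoeff : ContDiffOn ℝ ∞ (hopfCoeff F) Ω := by
  have h₁ := h.generating.smooth₁
  have h₂ := contDiffOn_conj h.generating.smooth₂
  exact (((h₂.mul (contDiffOn_dz h.isOpen h₁)).sub (h₁.mul (contDiffOn_dz h.isOpen h₂))).add
    (contDiffOn_const.mul ((h₂.pow 4).sub (h₁.pow 4)))).congr fun w hw => h.hopfCoeff_eq hw

theorem contDiffOn_meanCurvature : ContDiffOn ℝ ∞ (meanCurvature F) Ω := by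
  have h₁ := h.generating.smooth₁
  have h₂ := h.generating.smooth₂
  have hpos : ∀ w ∈ Ω, spinorSq (ψ₁ w) (ψ₂ w) ^ 2 ≠ 0 := fun w hw =>
    (pow_pos (spinorSq_pos (h.ne_zero w hw)) 2).ne'
  have h₁' := contDiffOn_conj h₁
  have h₂' := contDiffOn_conj h₂
  have hp := (contDiffOn_dzbar h.isOpen h₁).sub
    ((contDiffOn_const (c := (1 / 2 : ℂ)).mul (h₁'.pow 2)).mul h₂')
  have hc := (contDiffOn_conj (contDiffOn_dz h.isOpen h₂)).sub
    ((contDiffOn_const (c := (1 / 2 : ℂ)).mul h₁).mul (h₂.pow 2))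
  exact ((contDiffOn_const.mul (contDiffOn_re ((h₂'.mul hp).sub (h₁.mul hc)))).div
    (h.contDiffOn_spinorSq.pow 2) hpos).congr fun w hw =>
      (eq_div_iff (hpos w hw)).2 (h.meanCurvature_mul_spinorSq_sq hw)

theorem hasWirtingerDerivAt_logFactor (hζ : ζ ∈ Ω) :
    HasWirtingerDerivAt (fun w => (logFactor F w : ℂ)) (dz (fun w => (logFactor F w : ℂ)) ζ)
      (conj (dz (fun w => (logFactor F w : ℂ)) ζ)) ζ := by
  have hd := differentiableAt_of_contDiffOn h.isOpen h.contDiffOn_logFactor hζ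
  simpa only [dzbar_ofReal hd] using hasWirtingerDerivAt_ofReal hd

theorem hasWirtingerDerivAt_spinorSq (hζ : ζ ∈ Ω) :
    HasWirtingerDerivAt (fun w => (spinorSq (ψ₁ w) (ψ₂ w) : ℂ))
      (spinorSq (ψ₁ ζ) (ψ₂ ζ) * dz (fun w => (logFactor F w : ℂ)) ζ)
      (spinorSq (ψ₁ ζ) (ψ₂ ζ) * conj (dz (fun w => (logFactor F w : ℂ)) ζ)) ζ := by
  have hexp := (h.hasWirtingerDerivAt_logFactor hζ).ofReal_comp (Real.hasDerivAt_exp _)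
  rw [h.exp_logFactor hζ] at hexp
  refine hexp.congr_of_eventuallyEq ?_
  filter_upwards [h.isOpen.mem_nhds hζ] with w hw
  rw [h.exp_logFactor hw]

theorem spinorSq_mul_dz_logFactor (hζ : ζ ∈ Ω) :
    spinorSq (ψ₁ ζ) (ψ₂ ζ) * dz (fun w => (logFactor F w : ℂ)) ζ =
      conj (ψ₁ ζ) * (dz ψ₁ ζ + 1 / 2 * conj (ψ₂ ζ) ^ 3) +
        ψ₂ ζ * (dz (fun w => conj (ψ₂ w)) ζ + 1 / 2 * ψ₁ ζ ^ 3) := by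
  have h₁ := hasWirtingerDerivAt_dz_dzbar (h.differentiableAt₁ hζ)
  have h₂ := hasWirtingerDerivAt_dz_dzbar (h.differentiableAt₂ hζ)
  obtain ⟨hdzbar, hdz⟩ := h.regularDiracAt hζ
  have hnorm := ((h₁.mul h₁.star).add (h₂.mul h₂.star)).dz_eq
  simp only [← ofReal_spinorSq] at hnorm
  rw [← (h.hasWirtingerDerivAt_spinorSq hζ).dz_eq, hnorm, dz_conj (h.differentiableAt₂ hζ), hdzbar,
    hdz]
  simp only [map_add, map_mul, map_pow, map_div₀, map_one, map_ofNat, Complex.conj_conj,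
    Complex.conj_ofReal]
  ring

theorem hopfCoeff_mul_exp_neg_logFactor (hζ : ζ ∈ Ω) :
    hopfCoeff F ζ * Real.exp (-logFactor F ζ) = hopfCoeff F ζ / spinorSq (ψ₁ ζ) (ψ₂ ζ) := by
  rw [Real.exp_neg, h.exp_logFactor hζ, Complex.ofReal_inv, div_eq_mul_inv]

/-- `e^α α_ζ` and `A` are the components of `(∂ψ₁ + ψ̄₂³ / 2, ∂ψ̄₂ + ψ₁³ / 2)` in the frame
`(ψ₁, ψ̄₂)`, `(ψ₂, -ψ̄₁)`. -/
theorem weingarten (hζ : ζ ∈ Ω) :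
    dz ψ₁ ζ = dz (fun w => (logFactor F w : ℂ)) ζ * ψ₁ ζ
        + hopfCoeff F ζ * Real.exp (-logFactor F ζ) * ψ₂ ζ - 1 / 2 * conj (ψ₂ ζ) ^ 3 ∧
      dzbar ψ₂ ζ = -conj (hopfCoeff F ζ) * Real.exp (-logFactor F ζ) * ψ₁ ζ
        + dzbar (fun w => (logFactor F w : ℂ)) ζ * ψ₂ ζ - 1 / 2 * conj (ψ₁ ζ) ^ 3 := by
  have hr := h.ofReal_spinorSq_ne_zero hζ
  obtain ⟨hp, hc⟩ := spinorSq_mul_eq (conj (ψ₁ ζ)) (ψ₂ ζ) (dz ψ₁ ζ + 1 / 2 * conj (ψ₂ ζ) ^ 3)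
    (dz (fun w => conj (ψ₂ w)) ζ + 1 / 2 * ψ₁ ζ ^ 3)
  have hsq : spinorSq (conj (ψ₁ ζ)) (ψ₂ ζ) = spinorSq (ψ₁ ζ) (ψ₂ ζ) := by simp [spinorSq]
  have hA : conj (ψ₂ ζ) * (dz ψ₁ ζ + 1 / 2 * conj (ψ₂ ζ) ^ 3) -
      ψ₁ ζ * (dz (fun w => conj (ψ₂ w)) ζ + 1 / 2 * ψ₁ ζ ^ 3) = hopfCoeff F ζ := by
    rw [h.hopfCoeff_eq hζ]
    ring
  rw [hsq, Complex.conj_conj, ← h.spinorSq_mul_dz_logFactor hζ, hA] at hp hc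
  have hdz_conj : dz (fun w => conj (ψ₂ w)) ζ =
      -(hopfCoeff F ζ * Real.exp (-logFactor F ζ)) * conj (ψ₁ ζ)
        + dz (fun w => (logFactor F w : ℂ)) ζ * conj (ψ₂ ζ) - 1 / 2 * ψ₁ ζ ^ 3 := by
    rw [h.hopfCoeff_mul_exp_neg_logFactor hζ]
    field_simp
    linear_combination 2 * hc
  constructor
  · rw [h.hopfCoeff_mul_exp_neg_logFactor hζ]
    field_simp
    linear_combination 2 * hp
  · have hconj := congrArg conj hdz_conj
    rw [dz_conj (h.differentiableAt₂ hζ), Complex.conj_conj] at hconj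
    rw [hconj, (h.hasWirtingerDerivAt_logFactor hζ).dzbar_eq]
    simp only [map_add, map_sub, map_mul, map_neg, map_pow, map_div₀, map_one, map_ofNat,
      Complex.conj_conj, Complex.conj_ofReal]
    ring

theorem hasWirtingerDerivAt₁ (hζ : ζ ∈ Ω) : HasWirtingerDerivAt ψ₁
    (dz (fun w => (logFactor F w : ℂ)) ζ * ψ₁ ζ +
      hopfCoeff F ζ / spinorSq (ψ₁ ζ) (ψ₂ ζ) * ψ₂ ζ - 1 / 2 * conj (ψ₂ ζ) ^ 3)
    ((meanCurvature F ζ / 2 * spinorSq (ψ₁ ζ) (ψ₂ ζ) : ℝ) * ψ₂ ζ +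
      1 / 2 * (conj (ψ₁ ζ) ^ 2 * conj (ψ₂ ζ))) ζ := by
  refine (hasWirtingerDerivAt_dz_dzbar (h.differentiableAt₁ hζ)).congr_deriv ?_ ?_
  · rw [(h.weingarten hζ).1, h.hopfCoeff_mul_exp_neg_logFactor hζ]
  · rw [(h.regularDiracAt hζ).1]
    push_cast
    ring

theorem hasWirtingerDerivAt₂ (hζ : ζ ∈ Ω) : HasWirtingerDerivAt ψ₂
    (1 / 2 * (conj (ψ₂ ζ) ^ 2 * conj (ψ₁ ζ)) -
      (meanCurvature F ζ / 2 * spinorSq (ψ₁ ζ) (ψ₂ ζ) : ℝ) * ψ₁ ζ)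
    (conj (dz (fun w => (logFactor F w : ℂ)) ζ) * ψ₂ ζ -
      conj (hopfCoeff F ζ / spinorSq (ψ₁ ζ) (ψ₂ ζ)) * ψ₁ ζ - 1 / 2 * conj (ψ₁ ζ) ^ 3) ζ := by
  refine (hasWirtingerDerivAt_dz_dzbar (h.differentiableAt₂ hζ)).congr_deriv ?_ ?_
  · rw [(h.regularDiracAt hζ).2]
    push_cast
    ring
  · rw [(h.weingarten hζ).2, (h.hasWirtingerDerivAt_logFactor hζ).dzbar_eq,
      ← h.hopfCoeff_mul_exp_neg_logFactor hζ, map_mul, Complex.conj_ofReal]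
    ring

theorem hasWirtingerDerivAt_hopfCoeff_div_spinorSq (hζ : ζ ∈ Ω) : HasWirtingerDerivAt
    (fun w => hopfCoeff F w / spinorSq (ψ₁ w) (ψ₂ w))
    (dz (fun w => hopfCoeff F w / spinorSq (ψ₁ w) (ψ₂ w)) ζ)
    ((dzbar (hopfCoeff F) ζ - hopfCoeff F ζ * conj (dz (fun w => (logFactor F w : ℂ)) ζ)) /
      spinorSq (ψ₁ ζ) (ψ₂ ζ)) ζ := by
  have hr := h.ofReal_spinorSq_ne_zero hζ
  have hsmooth : ContDiffOn ℝ ∞ (fun w => hopfCoeff F w / (spinorSq (ψ₁ w) (ψ₂ w) : ℂ)) Ω :=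
    (h.contDiffOn_hopfCoeff.mul ((contDiffOn_ofReal h.contDiffOn_spinorSq).inv fun _ hw =>
      h.ofReal_spinorSq_ne_zero hw)).congr fun _ _ => div_eq_mul_inv _ _
  have hβ := hasWirtingerDerivAt_dz_dzbar (differentiableAt_of_contDiffOn h.isOpen hsmooth hζ)
  have hA : hopfCoeff F =ᶠ[𝓝 ζ] fun w => hopfCoeff F w / spinorSq (ψ₁ w) (ψ₂ w) *
      spinorSq (ψ₁ w) (ψ₂ w) := by
    filter_upwards [h.isOpen.mem_nhds hζ] with w hw
    rw [div_mul_cancel₀ _ (h.ofReal_spinorSq_ne_zero hw)]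
  have hprod := ((hβ.mul (h.hasWirtingerDerivAt_spinorSq hζ)).congr_of_eventuallyEq hA).dzbar_eq
  refine hβ.congr_deriv rfl ?_
  rw [hprod, eq_div_iff hr]
  field_simp
  ring

theorem hasWirtingerDerivAt_meanCurvature_mul_spinorSq (hζ : ζ ∈ Ω) : HasWirtingerDerivAt
    (fun w => ((meanCurvature F w / 2 * spinorSq (ψ₁ w) (ψ₂ w) : ℝ) : ℂ))
    (spinorSq (ψ₁ ζ) (ψ₂ ζ) / 2 * (dz (fun w => (meanCurvature F w : ℂ)) ζ +
      meanCurvature F ζ * dz (fun w => (logFactor F w : ℂ)) ζ))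
    (conj (spinorSq (ψ₁ ζ) (ψ₂ ζ) / 2 * (dz (fun w => (meanCurvature F w : ℂ)) ζ +
      meanCurvature F ζ * dz (fun w => (logFactor F w : ℂ)) ζ))) ζ := by
  have hdH := differentiableAt_of_contDiffOn h.isOpen h.contDiffOn_meanCurvature hζ
  have hH := hasWirtingerDerivAt_ofReal hdH
  rw [dzbar_ofReal hdH] at hH
  have hg := (hH.mul (h.hasWirtingerDerivAt_spinorSq hζ)).const_mul (1 / 2)
  have heq : (fun w => ((meanCurvature F w / 2 * spinorSq (ψ₁ w) (ψ₂ w) : ℝ) : ℂ)) =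
      fun w => 1 / 2 * ((meanCurvature F w : ℂ) * spinorSq (ψ₁ w) (ψ₂ w)) := by
    ext w
    push_cast
    ring
  rw [heq]
  refine hg.congr_deriv (by ring) ?_
  simp only [map_add, map_mul, map_div₀, map_ofNat, Complex.conj_ofReal]
  ring

theorem compatibility (hζ : ζ ∈ Ω) :
    dzbar (dz (fun w => (logFactor F w : ℂ))) ζ
        - hopfCoeff F ζ * conj (hopfCoeff F ζ) / spinorSq (ψ₁ ζ) (ψ₂ ζ) ^ 2
        + 1 / 4 * spinorSq (ψ₁ ζ) (ψ₂ ζ) ^ 2 * meanCurvature F ζ ^ 2 =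
      1 / 4 * (6 * (ψ₁ ζ * conj (ψ₁ ζ)) * (ψ₂ ζ * conj (ψ₂ ζ)) -
        ((ψ₁ ζ * conj (ψ₁ ζ)) ^ 2 + (ψ₂ ζ * conj (ψ₂ ζ)) ^ 2)) ∧
    dzbar (hopfCoeff F) ζ
        - 1 / 2 * dz (fun w => (meanCurvature F w : ℂ)) ζ * spinorSq (ψ₁ ζ) (ψ₂ ζ) ^ 2 =
      ((ψ₂ ζ * conj (ψ₂ ζ)) ^ 2 - (ψ₁ ζ * conj (ψ₁ ζ)) ^ 2) * (ψ₁ ζ * conj (ψ₂ ζ)) := by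
  have hr := h.ofReal_spinorSq_ne_zero hζ
  have hα := contDiffOn_ofReal h.contDiffOn_logFactor
  have hσ := hasWirtingerDerivAt_dz_dzbar
    (differentiableAt_of_contDiffOn h.isOpen (contDiffOn_dz h.isOpen hα) hζ)
  have hK : conj (dzbar (dz fun w => (logFactor F w : ℂ)) ζ) =
      dzbar (dz fun w => (logFactor F w : ℂ)) ζ :=
    Complex.conj_eq_iff_im.2 (im_dzbar_dz_ofReal h.isOpen h.contDiffOn_logFactor hζ)
  obtain ⟨hgauss, hcodazzi⟩ := compatibility_of_weingarten h.isOpen h.generating.smooth₁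
    h.generating.smooth₂ (fun w hw => h.hasWirtingerDerivAt₁ hw)
    (fun w hw => h.hasWirtingerDerivAt₂ hw) hζ (h.ne_zero ζ hζ) hσ hK
    (h.hasWirtingerDerivAt_hopfCoeff_div_spinorSq hζ)
    (h.hasWirtingerDerivAt_meanCurvature_mul_spinorSq hζ)
  push_cast at hgauss hcodazzi
  constructor
  · rw [← hgauss, map_div₀, Complex.conj_ofReal]
    field_simp
    ring
  · replace hcodazzi := congrArg ((spinorSq (ψ₁ ζ) (ψ₂ ζ) : ℂ) * ·) hcodazzi
    field_simp at hcodazzi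
    rw [ofReal_spinorSq] at hcodazzi ⊢
    linear_combination 1 / 2 * hcodazzi

theorem exp_two_mul_logFactor (hζ : ζ ∈ Ω) :
    Real.exp (2 * logFactor F ζ) = spinorSq (ψ₁ ζ) (ψ₂ ζ) ^ 2 := by
  rw [← h.exp_logFactor hζ, ← Real.exp_nat_mul, Nat.cast_ofNat]

theorem gauss_equation (hζ : ζ ∈ Ω) :
    dzbar (dz (fun w => (logFactor F w : ℂ))) ζ
        - (Real.exp (-2 * logFactor F ζ) * ‖hopfCoeff F ζ‖ ^ 2 : ℝ)
        + (1 / 4 * Real.exp (2 * logFactor F ζ) * meanCurvature F ζ ^ 2 : ℝ) =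
      (1 / 4 * (6 * ‖ψ₁ ζ‖ ^ 2 * ‖ψ₂ ζ‖ ^ 2 - (‖ψ₁ ζ‖ ^ 4 + ‖ψ₂ ζ‖ ^ 4)) : ℝ) := by
  have hcompat := (h.compatibility hζ).1
  simp only [Complex.mul_conj'] at hcompat
  rw [neg_mul, Real.exp_neg, h.exp_two_mul_logFactor hζ]
  push_cast
  linear_combination hcompat

theorem codazzi_equation (hζ : ζ ∈ Ω) :
    dzbar (hopfCoeff F) ζ - 1 / 2 * dz (fun w => (meanCurvature F w : ℂ)) ζ *
        Real.exp (2 * logFactor F ζ) =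
      (‖ψ₂ ζ‖ ^ 4 - ‖ψ₁ ζ‖ ^ 4 : ℝ) * (ψ₁ ζ * conj (ψ₂ ζ)) := by
  have hcompat := (h.compatibility hζ).2
  simp only [Complex.mul_conj'] at hcompat
  rw [h.exp_two_mul_logFactor hζ]
  push_cast
  linear_combination hcompat

end SpinorSurface

end WeingartenCodazzi

section SolDirac

variable {D : Set ℂ} {ψ₁ ψ₂ : ℂ → ℂ} {ζ : ℂ}

theorem regularSet_union_flatSet_subset : regularSet D ψ₁ ψ₂ ∪ flatSet D ψ₁ ψ₂ ⊆ D :=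
  Set.union_subset (fun _ hζ => hζ.1) fun _ hζ => (interior_subset hζ).1

theorem subset_closure_regularSet_union_flatSet (hD : IsOpen D) :
    D ⊆ closure (regularSet D ψ₁ ψ₂ ∪ flatSet D ψ₁ ψ₂) := by
  intro ζ hζ
  by_contra hcl
  refine hcl (subset_closure (Or.inr ?_))
  rw [flatSet, mem_interior_iff_mem_nhds]
  filter_upwards [isClosed_closure.isOpen_compl.mem_nhds hcl, hD.mem_nhds hζ] with w hw hwD
  by_contra hreg
  exact hw (subset_closure (Or.inl ⟨hwD, fun h0 => hreg ⟨hwD, h0⟩⟩))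

theorem contDiffOn_spinorVec (h₁ : ContDiffOn ℝ ∞ ψ₁ D) (h₂ : ContDiffOn ℝ ∞ ψ₂ D) (k : Fin 3) :
    ContDiffOn ℝ ∞ (fun w => spinorVec (ψ₁ w) (ψ₂ w) k) D := by
  have h₂' := contDiffOn_conj h₂
  fin_cases k
  · exact contDiffOn_const.mul ((h₂'.pow 2).add (h₁.pow 2))
  · exact contDiffOn_const.mul ((h₂'.pow 2).sub (h₁.pow 2))
  · exact h₁.mul h₂'

theorem contDiffOn_covDzbar {Z : ℂ → Fin 3 → ℂ} (hD : IsOpen D)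
    (hZ : ∀ k, ContDiffOn ℝ ∞ (fun w => Z w k) D) (k : Fin 3) :
    ContDiffOn ℝ ∞ (fun w => covDzbar Z w k) D := by
  have hZ' (j : Fin 3) := contDiffOn_conj (hZ j)
  refine (contDiffOn_dzbar hD (hZ k)).add ?_
  fin_cases k
  · exact (hZ' 0).mul (hZ 2)
  · exact ((hZ' 1).mul (hZ 2)).neg
  · exact ((hZ' 1).mul (hZ 1)).sub ((hZ' 0).mul (hZ 0))

theorem SolDirac.regularDiracAt {H : ℂ → ℝ} (hS : SolDirac D H ψ₁ ψ₂)
    (hζ : ζ ∈ regularSet D ψ₁ ψ₂) : RegularDiracAt (H ζ) ψ₁ ψ₂ ζ := by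
  have hne := hζ.2
  rw [mul_ne_zero_iff, map_ne_zero] at hne
  exact (diracAt_iff_regularDiracAt hne.1 hne.2).1 (hS.1 ζ hζ)

theorem SolDirac.exists_regularDiracAt {H : ℂ → ℝ} (hS : SolDirac D H ψ₁ ψ₂)
    (hζ : ζ ∈ regularSet D ψ₁ ψ₂ ∪ flatSet D ψ₁ ψ₂) : ∃ H : ℝ, RegularDiracAt H ψ₁ ψ₂ ζ := by
  rcases hζ with hreg | hflat
  · exact ⟨H ζ, hS.regularDiracAt hreg⟩
  · obtain ⟨hdz, hdzbar⟩ := hS.2 ζ hflat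
    have hzero : conj (ψ₁ ζ) * conj (ψ₂ ζ) = 0 := by simpa using (interior_subset hflat).2
    refine ⟨0, ?_, ?_⟩ <;> push_cast
    · linear_combination -hdzbar - 1 / 2 * conj (ψ₁ ζ) * hzero
    · linear_combination hdz - 1 / 2 * conj (ψ₂ ζ) * hzero

theorem SolDirac.im_covDzbar_spinorVec_eq_zero {H : ℂ → ℝ} (hS : SolDirac D H ψ₁ ψ₂)
    (hD : IsOpen D) (h₁ : ContDiffOn ℝ ∞ ψ₁ D) (h₂ : ContDiffOn ℝ ∞ ψ₂ D)
    (hne : ∀ ζ ∈ D, ψ₁ ζ ≠ 0 ∨ ψ₂ ζ ≠ 0) (hζ : ζ ∈ D) (k : Fin 3) :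
    (covDzbar (fun w => spinorVec (ψ₁ w) (ψ₂ w)) ζ k).im = 0 := by
  have hcont : ContinuousOn (fun w => (covDzbar (fun x => spinorVec (ψ₁ x) (ψ₂ x)) w k).im) D :=
    Complex.continuous_im.comp_continuousOn
      (contDiffOn_covDzbar hD (contDiffOn_spinorVec h₁ h₂) k).continuousOn
  have hsub := regularSet_union_flatSet_subset (D := D) (ψ₁ := ψ₁) (ψ₂ := ψ₂)
  have hdense : Set.EqOn (fun w => (covDzbar (fun x => spinorVec (ψ₁ x) (ψ₂ x)) w k).im)
      (fun _ => 0) (regularSet D ψ₁ ψ₂ ∪ flatSet D ψ₁ ψ₂) := fun w hw =>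
    (im_covDzbar_spinorVec_eq_zero_iff (differentiableAt_of_contDiffOn hD h₁ (hsub hw))
      (differentiableAt_of_contDiffOn hD h₂ (hsub hw)) (hne w (hsub hw))).2
        (hS.exists_regularDiracAt hw) k
  exact hdense.of_subset_closure hcont continuousOn_const hsub
    (subset_closure_regularSet_union_flatSet hD) hζ

theorem SolDirac.exists_spinorSurface [SimplyConnectedSpace D] {H : ℂ → ℝ}
    (hS : SolDirac D H ψ₁ ψ₂) (hD : IsOpen D) (h₁ : ContDiffOn ℝ ∞ ψ₁ D)
    (h₂ : ContDiffOn ℝ ∞ ψ₂ D) (hne : ∀ ζ ∈ D, ψ₁ ζ ≠ 0 ∨ ψ₂ ζ ≠ 0) (P : ℂ) (g : Sol) :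
    ∃ F : ℂ → Sol, F P = g ∧ SpinorSurface D F ψ₁ ψ₂ := by
  obtain ⟨F, hFP, hF, hvel⟩ := exists_velocityDz_eq hD (contDiffOn_spinorVec h₁ h₂)
    (fun ζ hζ => hS.im_covDzbar_spinorVec_eq_zero hD h₁ h₂ hne hζ) P g
  exact ⟨F, hFP, hD, hF, ⟨h₁, h₂, fun ζ hζ => (leftDz_eq_sum_iff hD hF hζ).2 (hvel ζ hζ)⟩, hne⟩

theorem SpinorSurface.isConformalSurfaceOn {F : ℂ → Sol} (h : SpinorSurface D F ψ₁ ψ₂) :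
    IsConformalSurfaceOn D F := by
  refine ⟨h.smooth, fun ζ hζ => ?_, h.isConformalOn⟩
  rw [injective_iff_map_eq_zero]
  intro v hv
  rw [← velocity_eq_zero_iff h.isOpen h.smooth hζ] at hv
  have hmetric := h.firstForm_eq hζ v v
  rw [firstForm, hv, zero_dotProduct, Complex.mul_conj, Complex.ofReal_re] at hmetric
  have hr := (pow_pos (spinorSq_pos (h.ne_zero ζ hζ)) 2).ne'
  exact Complex.normSq_eq_zero.1 ((mul_eq_zero.1 hmetric.symm).resolve_right hr)

end SolDirac

section Charts

variable {M : Type*} [TopologicalSpace M] [ChartedSpace ℂ M] {f : M → Sol}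
  {φ : OpenPartialHomeomorph M ℂ} {ζ : ℂ}

theorem IsSurface.contDiffOn_chart (hf : IsSurface f)
    (hφ : φ ∈ IsManifold.maximalAtlas 𝓘(ℝ, ℂ) ∞ M) :
    ContDiffOn ℝ ∞ (fun ζ (i j : Fin 3) => Sol.toMat (f (φ.symm ζ)) i j) φ.target :=
  contMDiffOn_iff_contDiffOn.1
    (hf.smooth.comp_contMDiffOn (contMDiffOn_symm_of_mem_maximalAtlas hφ))

theorem IsSurface.injective_fderiv_chart (hf : IsSurface f)
    (hφ : φ ∈ IsManifold.maximalAtlas 𝓘(ℝ, ℂ) ∞ M) (hζ : ζ ∈ φ.target) :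
    Function.Injective
      (fderiv ℝ (fun ζ (i j : Fin 3) => Sol.toMat (f (φ.symm ζ)) i j) ζ) := by
  have hmd : φ.MDifferentiable 𝓘(ℝ, ℂ) 𝓘(ℝ, ℂ) :=
    ⟨(contMDiffOn_of_mem_maximalAtlas hφ).mdifferentiableOn (by simp),
      (contMDiffOn_symm_of_mem_maximalAtlas hφ).mdifferentiableOn (by simp)⟩
  have hcomp := mfderiv_comp ζ (hf.smooth.mdifferentiableAt (x := φ.symm ζ) (by simp))
    (hmd.mdifferentiableAt_symm hζ)
  have hinj := (hf.immersion (φ.symm ζ)).comp (hmd.symm.mfderiv_injective hζ)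
  rw [← ContinuousLinearMap.coe_comp, ← hcomp, mfderiv_eq_fderiv] at hinj
  exact hinj

theorem IsSurface.spinorSurface (hf : IsSurface f) (hφ : φ ∈ IsManifold.maximalAtlas 𝓘(ℝ, ℂ) ∞ M)
    {ψ₁ ψ₂ : ℂ → ℂ} (hψ : IsGeneratingSpinor φ.target (fun ζ => f (φ.symm ζ)) ψ₁ ψ₂) :
    SpinorSurface φ.target (fun ζ => f (φ.symm ζ)) ψ₁ ψ₂ := by
  have hF := hf.contDiffOn_chart hφ
  refine ⟨φ.open_target, hF, hψ, fun ζ hζ => ?_⟩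
  by_contra! hzero
  have hvelDz := (leftDz_eq_sum_iff φ.open_target hF hζ).1 (hψ.eq ζ hζ)
  have hvel : velocity (fun ζ => f (φ.symm ζ)) 1 ζ = 0 := by
    ext k
    rw [velocity_eq_re_velocityDz, hvelDz, hzero.1, hzero.2]
    fin_cases k <;> simp [spinorVec]
  rw [velocity_eq_zero_iff φ.open_target hF hζ] at hvel
  exact one_ne_zero ((injective_iff_map_eq_zero _).1 (hf.injective_fderiv_chart hφ hζ) 1 hvel)

end Charts

end

theorem mainTheorem3 :
    (∀ (M : Type*) [TopologicalSpace M] [ChartedSpace ℂ M] [IsManifold 𝓘(ℝ, ℂ) ∞ M]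
      (f : M → Sol) (_ : IsSurface f)
      (φ : OpenPartialHomeomorph M ℂ) (_ : φ ∈ IsManifold.maximalAtlas 𝓘(ℝ, ℂ) ∞ M)
      (F : ℂ → Sol) (_ : F = fun ζ => f (φ.symm ζ)) (_ : IsConformalOn φ.target F)
      (ψ₁ ψ₂ : ℂ → ℂ) (_ : IsGeneratingSpinor φ.target F ψ₁ ψ₂)
      (α : ℂ → ℝ) (_ : α = logFactor F) (H : ℂ → ℝ) (_ : H = meanCurvature F)
      (A : ℂ → ℂ) (_ : A = hopfCoeff F),
      -- the Dirac equations
      SolDirac φ.target H ψ₁ ψ₂ ∧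
      -- the Hopf differential
      (∀ ζ ∈ φ.target,
        A ζ = (conj (ψ₂ ζ) * dz ψ₁ ζ - ψ₁ ζ * dz (fun w => conj (ψ₂ w)) ζ)
          + 1 / 2 * (conj (ψ₂ ζ) ^ 4 - ψ₁ ζ ^ 4)) ∧
      -- the remaining Weingarten equations
      (∀ ζ ∈ flatSet φ.target ψ₁ ψ₂ ∪ regularSet φ.target ψ₁ ψ₂,
        dz ψ₁ ζ = dz (fun w => (α w : ℂ)) ζ * ψ₁ ζ
          + A ζ * Real.exp (-α ζ) * ψ₂ ζ - 1 / 2 * conj (ψ₂ ζ) ^ 3 ∧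
        dzbar ψ₂ ζ = -conj (A ζ) * Real.exp (-α ζ) * ψ₁ ζ
          + dzbar (fun w => (α w : ℂ)) ζ * ψ₂ ζ - 1 / 2 * conj (ψ₁ ζ) ^ 3) ∧
      -- the Codazzi equations
      (∀ ζ ∈ φ.target,
        dzbar (dz (fun w => (α w : ℂ))) ζ - (Real.exp (-2 * α ζ) * ‖A ζ‖ ^ 2 : ℝ)
            + (1 / 4 * Real.exp (2 * α ζ) * H ζ ^ 2 : ℝ)
          = (1 / 4 * (6 * ‖ψ₁ ζ‖ ^ 2 * ‖ψ₂ ζ‖ ^ 2 - (‖ψ₁ ζ‖ ^ 4 + ‖ψ₂ ζ‖ ^ 4)) : ℝ) ∧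
        dzbar A ζ - 1 / 2 * dz (fun w => (H w : ℂ)) ζ * Real.exp (2 * α ζ)
          = (‖ψ₂ ζ‖ ^ 4 - ‖ψ₁ ζ‖ ^ 4 : ℝ) * (ψ₁ ζ * conj (ψ₂ ζ)))) ∧
    -- solutions of the Dirac equations generate surfaces
    (∀ (D : Set ℂ) (_ : IsOpen D) (_ : SimplyConnectedSpace D)
      (ψ₁ ψ₂ : ℂ → ℂ) (_ : ContDiffOn ℝ ∞ ψ₁ D) (_ : ContDiffOn ℝ ∞ ψ₂ D)
      (_ : ∀ ζ ∈ D, ψ₁ ζ ≠ 0 ∨ ψ₂ ζ ≠ 0)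
      (H : ℂ → ℝ) (_ : SolDirac D H ψ₁ ψ₂) (P : ℂ) (_ : P ∈ D) (g : Sol),
      ∃ F : ℂ → Sol, F P = g ∧ IsConformalSurfaceOn D F ∧ IsGeneratingSpinor D F ψ₁ ψ₂ ∧
        ∀ ζ ∈ regularSet D ψ₁ ψ₂, meanCurvature F ζ = H ζ) := by
  refine ⟨?_, ?_⟩
  · rintro M _ _ _ f hf φ hφ F rfl - ψ₁ ψ₂ hψ α rfl H rfl A rfl
    have h := hf.spinorSurface hφ hψ
    exact ⟨h.solDirac, fun ζ hζ => h.hopfCoeff_eq hζ,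
      fun ζ hζ => h.weingarten (regularSet_union_flatSet_subset hζ.symm),
      fun ζ hζ => ⟨h.gauss_equation hζ, h.codazzi_equation hζ⟩⟩
  · intro D hD _ ψ₁ ψ₂ h₁ h₂ hne H hS P _ g
    obtain ⟨F, hFP, h⟩ := hS.exists_spinorSurface hD h₁ h₂ hne P g
    refine ⟨F, hFP, h.isConformalSurfaceOn, h.generating, fun ζ hζ => ?_⟩
    exact h.eq_meanCurvature_of_regularDiracAt hζ.1 (hS.regularDiracAt hζ)
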